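/- Let $SG(0)$ be a triangle with leftmost, rightmost and topmost vertices $o,a_0,b_0$, and let $SG(n+1)$ be the juxtaposition of three copies of $SG(n)$ (lower left, lower right, top), each pair sharing one corner; the lower-left copy is identified with $SG(n)$, so $SG(0)\subset SG(1)\subset\cdots$ all share the leftmost vertex $o$. Let $a_m,b_m$ be the rightmost and topmost vertices of $SG(m)$, and $c_m$ the midpoint of the side $a_{m+1}b_{m+1}$ of $SG(m+1)$. For $m\ge1$ let $a_{m,1},b_{m,1},c_{m,1}$ be the midpoints of the segments $a_ma_{m+1}$, $a_mc_m$, $a_{m+1}c_m$ respectively. For a vertex $x$ let $\tilde x$ be its reflection in the line through $o$ and $c_0$, and for a vertex $x$ of $SG(n)$, $n\ge1$, let $\hat x$ be its reflection in the line through $a_n$ and $b_{n-1}$. For a vertex $x$ of $SG(n)$ let $F_j(n,x)$ be the number of spanning trees of $SG(n)$ with exactly $j$ edges at $x$ divided by the number of all spanning trees. Let $G_j(n,x)$ be the analogous proportion among the spanning forests of $SG(n)$ with exactly two trees, one containing $b_n$ and the other containing both $o$ and $a_n$, and let $H_j(n,x)$ be the analogous proportion among the spanning forests with exactly three trees such that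 $o,a_n,b_n$ lie in different trees (single-vertex trees are allowed). For $n\ge2$ let $B_j(n-1,n-2)$ be the $3\times5$ matrix whose rows, for $x=a_{n-2},\,b_{n-2},\,c_{n-2}$ in this order, are \[ \bigl(F_j(n-1,x),\ G_j(n-1,x),\ G_j(n-1,\tilde x),\ G_j(n-1,\hat x),\ H_j(n-1,x)\bigr), \] where $\hat x$ is taken in $SG(n-1)$. Put $e_1=(1,0,0,0,0)^T$, \[ R=\begin{pmatrix} \frac23&\frac35&\frac1{10}&\frac35&\frac6{25}\\ \frac16&\frac3{10}&\frac1{10}&\frac1{10}&\frac7{50}\\ 0&0&\frac25&0&\frac6{25}\\ \frac16&\frac1{10}&\frac1{10}&\frac3{10}&\frac7{50}\\ 0&0&\frac3{10}&0&\frac6{25} \end{pmatrix},\qquad L=\begin{pmatrix} \frac23&\frac35&\frac35&\frac35&\frac6{25}\\ \frac16&\frac3{10}&\frac1{10}&0&\frac7{50}\\ \frac16&\frac1{10}&\frac3{10}&\frac1{10}&\frac7{50}\\ 0&0&0&\frac3{10}&\frac6{25}\\ 0&0&0&0&\frac6{25} \end{pmatrix}. \] Then for all $n\ge2$, $m\ge0$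 and $j\in\{1,2,3,4\}$, \[ \begin{pmatrix}F_j(n+m,a_{n-1,1})\\F_j(n+m,b_{n-1,1})\\F_j(n+m,c_{n-1,1})\end{pmatrix} =\begin{pmatrix}F_j(n+m,\tilde a_{n-1,1})\\F_j(n+m,\tilde b_{n-1,1})\\F_j(n+m,\tilde c_{n-1,1})\end{pmatrix} =B_j(n-1,n-2)\,R\,L^m e_1 . \] -/

import Mathlib

namespace SG

open Classical in
/-- Vertices of the stage-`n` gasket `SG(n)`, in the lattice coordinates in which `(i, j)` is the
point `i • u + j • v`, where `u`, `v` are unit vectors from the leftmost vertex `o = (0, 0)`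
along the horizontal side and along the left side.  Stage `n + 1` is the juxtaposition
of three copies of stage `n`. -/
noncomputable def verts : ℕ → Finset (ℕ × ℕ)
  | 0 => {(0, 0), (1, 0), (0, 1)}
  | n + 1 => verts n ∪ (verts n).image (fun p => (p.1 + 2 ^ n, p.2))
      ∪ (verts n).image (fun p => (p.1, p.2 + 2 ^ n))

open Classical in
/-- Edges (bonds) of `SG(n)`. -/
noncomputable def edges : ℕ → Finset (Sym2 (ℕ × ℕ))
  | 0 => {s((0, 0), (1, 0)), s((0, 0), (0, 1)), s((1, 0), (0, 1))}
  | n + 1 => edges n ∪ (edges n).image (Sym2.map fun p => (p.1 + 2 ^ n, p.2))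
      ∪ (edges n).image (Sym2.map fun p => (p.1, p.2 + 2 ^ n))

/-- The leftmost vertex `o`. -/
def o : ℕ × ℕ := (0, 0)

/-- `a_m`, the rightmost vertex of `SG(m)`. -/
def a (m : ℕ) : ℕ × ℕ := (2 ^ m, 0)

/-- `b_m`, the topmost vertex of `SG(m)`. -/
def b (m : ℕ) : ℕ × ℕ := (0, 2 ^ m)

/-- `c_m`: the vertices `a_m`, `b_m`, `c_m` demarcate the largest lacunary triangle
of `SG(m + 1)`. -/
def c (m : ℕ) : ℕ × ℕ := (2 ^ m, 2 ^ m)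

theorem o_mem (n : ℕ) : o ∈ verts n := by
  induction n with
  | zero => simp [verts, o]
  | succ n ih => simp only [verts, Finset.mem_union]; exact Or.inl (Or.inl ih)

theorem a_mem (n : ℕ) : a n ∈ verts n := by
  induction n with
  | zero => simp [verts, a]
  | succ n ih =>
    simp only [verts, Finset.mem_union, Finset.mem_image]
    exact Or.inl (Or.inr ⟨a n, ih, by simp [a, pow_succ, mul_two]⟩)

theorem b_mem (n : ℕ) : b n ∈ verts n := by
  induction n with
  | zero => simp [verts, b]
  | succ n ih =>
    simp only [verts, Finset.mem_union, Finset.mem_image]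
    exact Or.inr ⟨b n, ih, by simp [b, pow_succ, mul_two]⟩

/-- The spanning subgraph of `SG(n)` with edge set `S` (used for `S ⊆ edges n`): its vertex set
is all of `verts n`. -/
def spanSub (n : ℕ) (S : Finset (Sym2 (ℕ × ℕ))) : SimpleGraph (verts n) :=
  (SimpleGraph.fromEdgeSet (S : Set (Sym2 (ℕ × ℕ)))).induce (verts n : Set (ℕ × ℕ))

open Classical in
/-- The number of bonds of `S` connected to the vertex `x`. -/
noncomputable def bonds (S : Finset (Sym2 (ℕ × ℕ))) (x : ℕ × ℕ) : ℕ :=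
  (S.filter fun e => x ∈ e).card

/-- The vertex `o`, as an element of the vertex set of `SG(n)`. -/
def oV (n : ℕ) : verts n := ⟨o, o_mem n⟩

/-- The vertex `a_n`, as an element of the vertex set of `SG(n)`. -/
def aV (n : ℕ) : verts n := ⟨a n, a_mem n⟩

/-- The vertex `b_n`, as an element of the vertex set of `SG(n)`. -/
def bV (n : ℕ) : verts n := ⟨b n, b_mem n⟩

open Classical in
/-- Spanning trees of `SG(n)`. -/
noncomputable def trees (n : ℕ) : Finset (Finset (Sym2 (ℕ × ℕ))) :=
  (edges n).powerset.filter fun S => (spanSub n S).IsTree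

open Classical in
/-- Spanning subgraphs of `SG(n)` with two trees such that `b_n` belongs to one tree and
`o`, `a_n` belong to the other. -/
noncomputable def forests₂ (n : ℕ) : Finset (Finset (Sym2 (ℕ × ℕ))) :=
  (edges n).powerset.filter fun S =>
    (spanSub n S).IsAcyclic ∧ Nat.card (spanSub n S).ConnectedComponent = 2 ∧
      (spanSub n S).Reachable (oV n) (aV n) ∧ ¬ (spanSub n S).Reachable (oV n) (bV n)

open Classical in
/-- Spanning subgraphs of `SG(n)` with three trees such that `o`, `a_n`, `b_n` belong to
different trees. -/
noncomputable def forests₃ (n : ℕ) : Finset (Finset (Sym2 (ℕ × ℕ))) :=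
  (edges n).powerset.filter fun S =>
    (spanSub n S).IsAcyclic ∧ Nat.card (spanSub n S).ConnectedComponent = 3 ∧
      ¬ (spanSub n S).Reachable (oV n) (aV n) ∧ ¬ (spanSub n S).Reachable (oV n) (bV n) ∧
      ¬ (spanSub n S).Reachable (aV n) (bV n)

/-- `F_j(n, x)`: the fraction of spanning trees of `SG(n)` with `j` bonds at `x`. -/
noncomputable def F (j n : ℕ) (x : ℕ × ℕ) : ℚ :=
  (((trees n).filter fun S => bonds S x = j).card : ℚ) / ((trees n).card : ℚ)

/-- `G_j(n, x)`: the same for the two-tree spanning subgraphs. -/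
noncomputable def G (j n : ℕ) (x : ℕ × ℕ) : ℚ :=
  (((forests₂ n).filter fun S => bonds S x = j).card : ℚ) / ((forests₂ n).card : ℚ)

/-- `H_j(n, x)`: the same for the three-tree spanning subgraphs. -/
noncomputable def H (j n : ℕ) (x : ℕ × ℕ) : ℚ :=
  (((forests₃ n).filter fun S => bonds S x = j).card : ℚ) / ((forests₃ n).card : ℚ)

/-- `x̃`: reflection with respect to the line through `o` and `c_0`. -/
def tilde (x : ℕ × ℕ) : ℕ × ℕ := (x.2, x.1)

/-- `x̂` in `SG(n)`: reflection with respect to the line through `a_n` and the midpoint `b_{n-1}`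
of `o` and `b_n`; it fixes `a_n` and exchanges `o` and `b_n`.  On `SG(n)` one has
`x.1 + x.2 ≤ 2 ^ n`, so the subtraction is not truncated. -/
def hat (n : ℕ) (x : ℕ × ℕ) : ℕ × ℕ := (x.1, 2 ^ n - x.1 - x.2)

/-- The vertices `a_m`, `b_m`, `c_m`. -/
def vtx (m : ℕ) : Fin 3 → ℕ × ℕ := ![a m, b m, c m]

/-- For `m ≥ 1` the vertices `a_{m,1}`, `b_{m,1}`, `c_{m,1}`, which demarcate the largest lacunary
triangle inside the triangle with outmost vertices `a_m`, `a_{m+1}`, `c_m`: the midpoints of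
`a_m a_{m+1}`, of `a_m c_m`, and of `a_{m+1} c_m`. -/
def vtxOne (m : ℕ) : Fin 3 → ℕ × ℕ :=
  ![(2 ^ m + 2 ^ (m - 1), 0), (2 ^ m, 2 ^ (m - 1)), (2 ^ m + 2 ^ (m - 1), 2 ^ (m - 1))]

/-- The matrix `B_j(N, γ)` for a subscript `γ` whose three vertices `a_γ, b_γ, c_γ` are `v 0, v 1, v 2`
and lie in `SG(n)`, `n ≤ N`; the reflection `x̂` is the one of `SG(n)`. -/
noncomputable def B (j N n : ℕ) (v : Fin 3 → ℕ × ℕ) : Matrix (Fin 3) (Fin 5) ℚ :=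
  Matrix.of fun i =>
    ![F j N (v i), G j N (v i), G j N (tilde (v i)), G j N (hat n (v i)), H j N (v i)]

/-- The matrix `L`. -/
def L : Matrix (Fin 5) (Fin 5) ℚ :=
  !![2/3, 3/5,  3/5,  3/5,  6/25;
     1/6, 3/10, 1/10, 0,    7/50;
     1/6, 1/10, 3/10, 1/10, 7/50;
     0,   0,    0,    3/10, 6/25;
     0,   0,    0,    0,    6/25]

/-- The matrix `R`. -/
def R : Matrix (Fin 5) (Fin 5) ℚ :=
  !![2/3, 3/5,  1/10, 3/5,  6/25;
     1/6, 3/10, 1/10, 1/10, 7/50;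
     0,   0,    2/5,  0,    6/25;
     1/6, 1/10, 1/10, 3/10, 7/50;
     0,   0,    3/10, 0,    6/25]

/-- The vector `(1,0,0,0,0)ᵀ`. -/
def e₁ : Fin 5 → ℚ := ![1, 0, 0, 0, 0]

end SG

/-! Cutting a spanning subgraph of SG(n+1) along its three copies of SG(n) gives three freely chosen
spanning subgraphs. Consider forests each tree of which contains a corner, sorted by the partition
they induce on the three corners: five patterns, namely all together (trees), one corner isolated
(three ways), all separate. A glued subgraph is such a forest exactly when its pieces are and their
patterns are compatible, and its pattern is then determined by theirs (`isForest_glue`, `Pat.comb`).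
So counts weighted by a product over the pieces obey a trilinear recursion (`Z_succ`).

If the weight is the indicator of j bonds at a vertex x met by a single copy, the two other factors
are the plain totals f, g, g, g, h of the five patterns, and the recursion is linear in the five
proportions at x. The invariant f h = 3 g² (`total_relations`) makes the normalised coefficients
independent of n: they are entries of `L` for x in the left copy and of `R` for x in the right copy
(`prop_left`, `prop_right`). Only the first three columns are ever used, since `L` preserves the
vectors with vanishing last two coordinates and `e₁` is one of them.

The vertices in question are a_{n-2}, b_{n-2}, c_{n-2} translated to the right copy, whence one
factor `R` and then m factors `L`. The reflections of the gasket permute the patterns with one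
isolated corner; this identifies the five proportions with a row of `B` (`B_apply`) and gives
equality at x̃. -/

namespace SG

/-! ### Connectivity and acyclicity of two pieces sharing at most two vertices. -/

section Gluing

variable {V : Type*}

/-- Reachability along the edges of `S`. -/
def Conn (S : Set (Sym2 V)) (u v : V) : Prop := (SimpleGraph.fromEdgeSet S).Reachable u v

theorem Conn.refl (S : Set (Sym2 V)) (u : V) : Conn S u u := SimpleGraph.Reachable.refl u

theorem Conn.symm {S : Set (Sym2 V)} {u v : V} (h : Conn S u v) : Conn S v u :=
  SimpleGraph.Reachable.symm h

theorem Conn.comm {S : Set (Sym2 V)} {u v : V} : Conn S u v ↔ Conn S v u := ⟨.symm, .symm⟩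

theorem Conn.trans {S : Set (Sym2 V)} {u v w : V} (h : Conn S u v) (h' : Conn S v w) :
    Conn S u w :=
  SimpleGraph.Reachable.trans h h'

theorem Conn.mono {S T : Set (Sym2 V)} (hST : S ⊆ T) {u v : V} (h : Conn S u v) : Conn T u v :=
  SimpleGraph.Reachable.mono (SimpleGraph.fromEdgeSet_mono hST) h

theorem Conn.of_mem {S : Set (Sym2 V)} {u v : V} (h : s(u, v) ∈ S) : Conn S u v := by
  by_cases huv : u = v
  · exact huv ▸ Conn.refl S u
  · exact SimpleGraph.Adj.reachable (by simp [h, huv])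

theorem Conn.induction {S : Set (Sym2 V)} {u : V} {P : V → Prop} (h0 : P u)
    (hs : ∀ v w, s(v, w) ∈ S → P v → P w) {v : V} (h : Conn S u v) : P v := by
  rw [Conn, SimpleGraph.reachable_iff_reflTransGen] at h
  induction h with
  | refl => exact h0
  | tail _ hadj ih => exact hs _ _ ((SimpleGraph.fromEdgeSet_adj S).1 hadj).1 ih

/-- All endpoints of the edges of `S` lie in `U`. -/
def SuppIn (S : Set (Sym2 V)) (U : Set V) : Prop := ∀ e ∈ S, ∀ v ∈ e, v ∈ U

theorem SuppIn.union {S T : Set (Sym2 V)} {U W : Set V} (hS : SuppIn S U) (hT : SuppIn T W) :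
    SuppIn (S ∪ T) (U ∪ W) := by
  rintro e (he | he) v hv
  · exact Or.inl (hS e he v hv)
  · exact Or.inr (hT e he v hv)

theorem Conn.mem_or_eq {S : Set (Sym2 V)} {U : Set V} (hS : SuppIn S U) {u v : V}
    (h : Conn S u v) : v ∈ U ∨ v = u := by
  refine Conn.induction (P := fun v => v ∈ U ∨ v = u) (Or.inr rfl) ?_ h
  intro v w hvw _
  exact Or.inl (hS _ hvw w (by simp))

section TwoPieces

variable {S T : Set (Sym2 V)} {U W : Set V} {p q : V}

/-- The four alternatives form an invariant along a path: T is entered and left only through p and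
q, so an excursion matters only if it joins p to q. One excursion suffices, as a second one would
come back to a vertex already reached inside S. -/
theorem Conn.union_cases (hS : SuppIn S U) (hT : SuppIn T W)
    (hUW : ∀ v ∈ U, v ∈ W → v = p ∨ v = q) {u w : V} (hu : u ∈ U) (h : Conn (S ∪ T) u w) :
    Conn S u w ∨ (Conn T p q ∧ (Conn S u p ∧ Conn S q w ∨ Conn S u q ∧ Conn S p w)) ∨
      (Conn S u p ∧ Conn T p w) ∨ (Conn S u q ∧ Conn T q w) := by
  refine Conn.induction (P := fun w => Conn S u w ∨
    (Conn T p q ∧ (Conn S u p ∧ Conn S q w ∨ Conn S u q ∧ Conn S p w)) ∨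
      (Conn S u p ∧ Conn T p w) ∨ (Conn S u q ∧ Conn T q w)) (Or.inl (Conn.refl S u)) ?_ h
  clear h w
  rintro v w (hvw | hvw) hv
  · have hvU := hS _ hvw v (by simp)
    have hadj : Conn S v w := Conn.of_mem hvw
    rcases hv with h | ⟨h, ⟨h1, h2⟩ | ⟨h1, h2⟩⟩ | ⟨h1, h2⟩ | ⟨h1, h2⟩
    · exact Or.inl (h.trans hadj)
    · exact Or.inr (Or.inl ⟨h, Or.inl ⟨h1, h2.trans hadj⟩⟩)
    · exact Or.inr (Or.inl ⟨h, Or.inr ⟨h1, h2.trans hadj⟩⟩)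
    · rcases (h2.mem_or_eq hT).elim (hUW v hvU) Or.inl with rfl | rfl
      · exact Or.inl (h1.trans hadj)
      · exact Or.inr (Or.inl ⟨h2, Or.inl ⟨h1, hadj⟩⟩)
    · rcases (h2.mem_or_eq hT).elim (hUW v hvU) Or.inr with rfl | rfl
      · exact Or.inr (Or.inl ⟨h2.symm, Or.inr ⟨h1, hadj⟩⟩)
      · exact Or.inl (h1.trans hadj)
  · have hvW := hT _ hvw v (by simp)
    have hadj : Conn T v w := Conn.of_mem hvw
    rcases hv with h | ⟨h, ⟨h1, h2⟩ | ⟨h1, h2⟩⟩ | ⟨h1, h2⟩ | ⟨h1, h2⟩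
    · have hvU : v ∈ U := (h.mem_or_eq hS).elim id (fun e => e ▸ hu)
      rcases hUW v hvU hvW with rfl | rfl
      · exact Or.inr (Or.inr (Or.inl ⟨h, hadj⟩))
      · exact Or.inr (Or.inr (Or.inr ⟨h, hadj⟩))
    · rcases (h2.mem_or_eq hS).elim (fun hvU => hUW v hvU hvW) Or.inr with rfl | rfl
      · exact Or.inr (Or.inr (Or.inl ⟨h1, hadj⟩))
      · exact Or.inr (Or.inr (Or.inl ⟨h1, h.trans hadj⟩))
    · rcases (h2.mem_or_eq hS).elim (fun hvU => hUW v hvU hvW) Or.inl with rfl | rfl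
      · exact Or.inr (Or.inr (Or.inr ⟨h1, h.symm.trans hadj⟩))
      · exact Or.inr (Or.inr (Or.inr ⟨h1, hadj⟩))
    · exact Or.inr (Or.inr (Or.inl ⟨h1, h2.trans hadj⟩))
    · exact Or.inr (Or.inr (Or.inr ⟨h1, h2.trans hadj⟩))

theorem conn_union_same (hS : SuppIn S U) (hT : SuppIn T W)
    (hUW : ∀ v ∈ U, v ∈ W → v = p ∨ v = q) {u w : V} (hu : u ∈ U) (hw : w ∈ U) :
    Conn (S ∪ T) u w ↔
      Conn S u w ∨ (Conn T p q ∧ (Conn S u p ∧ Conn S q w ∨ Conn S u q ∧ Conn S p w)) := by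
  have l : ∀ {a b}, Conn S a b → Conn (S ∪ T) a b := Conn.mono Set.subset_union_left
  have r : ∀ {a b}, Conn T a b → Conn (S ∪ T) a b := Conn.mono Set.subset_union_right
  constructor
  · intro h
    rcases h.union_cases hS hT hUW hu with h | h | ⟨h1, h2⟩ | ⟨h1, h2⟩
    · exact Or.inl h
    · exact Or.inr h
    · rcases (h2.mem_or_eq hT).elim (hUW w hw) Or.inl with rfl | rfl
      · exact Or.inl h1
      · exact Or.inr ⟨h2, Or.inl ⟨h1, Conn.refl _ _⟩⟩
    · rcases (h2.mem_or_eq hT).elim (hUW w hw) Or.inr with rfl | rfl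
      · exact Or.inr ⟨h2.symm, Or.inr ⟨h1, Conn.refl _ _⟩⟩
      · exact Or.inl h1
  · rintro (h | ⟨h, ⟨h1, h2⟩ | ⟨h1, h2⟩⟩)
    · exact l h
    · exact (l h1).trans ((r h).trans (l h2))
    · exact (l h1).trans ((r h).symm.trans (l h2))

theorem conn_union_cross (hS : SuppIn S U) (hT : SuppIn T W)
    (hUW : ∀ v ∈ U, v ∈ W → v = p ∨ v = q) {u w : V} (hu : u ∈ U) (hw : w ∈ W) :
    Conn (S ∪ T) u w ↔ (Conn S u p ∧ Conn T p w) ∨ (Conn S u q ∧ Conn T q w) := by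
  have l : ∀ {a b}, Conn S a b → Conn (S ∪ T) a b := Conn.mono Set.subset_union_left
  have r : ∀ {a b}, Conn T a b → Conn (S ∪ T) a b := Conn.mono Set.subset_union_right
  constructor
  · intro h
    rcases h.union_cases hS hT hUW hu with h | ⟨h, ⟨h1, h2⟩ | ⟨h1, h2⟩⟩ | h | h
    · have hwU : w ∈ U := (h.mem_or_eq hS).elim id (fun e => e ▸ hu)
      rcases hUW w hwU hw with rfl | rfl
      · exact Or.inl ⟨h, Conn.refl _ _⟩
      · exact Or.inr ⟨h, Conn.refl _ _⟩
    · rcases (h2.mem_or_eq hS).elim (fun hU => hUW w hU hw) Or.inr with rfl | rfl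
      · exact Or.inl ⟨h1, Conn.refl _ _⟩
      · exact Or.inl ⟨h1, h⟩
    · rcases (h2.mem_or_eq hS).elim (fun hU => hUW w hU hw) Or.inl with rfl | rfl
      · exact Or.inr ⟨h1, h.symm⟩
      · exact Or.inr ⟨h1, Conn.refl _ _⟩
    · exact Or.inl h
    · exact Or.inr h
  · rintro (⟨h1, h2⟩ | ⟨h1, h2⟩)
    · exact (l h1).trans (r h2)
    · exact (l h1).trans (r h2)

theorem Conn.exit (hS : SuppIn S U) (hT : SuppIn T W)
    (hUW : ∀ v ∈ U, v ∈ W → v = p ∨ v = q) {u w : V} (hu : u ∈ U) (hw : w ∈ W)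
    (h : Conn (S ∪ T) u w) : Conn S u p ∨ Conn S u q :=
  ((conn_union_cross hS hT hUW hu hw).1 h).imp And.left And.left

theorem Conn.exit_same (hS : SuppIn S U) (hT : SuppIn T W)
    (hUW : ∀ v ∈ U, v ∈ W → v = p ∨ v = q) {u w : V} (hu : u ∈ U) (hw : w ∈ U)
    (h : Conn (S ∪ T) u w) : Conn S u w ∨ Conn S u p ∨ Conn S u q := by
  rcases (conn_union_same hS hT hUW hu hw).1 h with h | ⟨-, h | h⟩
  · exact Or.inl h
  · exact Or.inr (Or.inl h.1)
  · exact Or.inr (Or.inr h.1)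

end TwoPieces

/-- The edges of `S` form a forest. -/
def Acyc (S : Set (Sym2 V)) : Prop := (SimpleGraph.fromEdgeSet S).IsAcyclic

theorem fromEdgeSet_insert (S : Set (Sym2 V)) (u v : V) :
    SimpleGraph.fromEdgeSet (insert s(u, v) S) =
      SimpleGraph.fromEdgeSet S ⊔ SimpleGraph.edge u v := by
  rw [Set.insert_eq, Set.union_comm, SimpleGraph.edge, SimpleGraph.fromEdgeSet_union]

/-- The case u = v is harmless because `fromEdgeSet` discards loops. -/
theorem acyc_insert {S : Set (Sym2 V)} {u v : V} (h : s(u, v) ∉ S) :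
    Acyc (insert s(u, v) S) ↔ Acyc S ∧ (Conn S u v → u = v) := by
  rw [Acyc, fromEdgeSet_insert, SimpleGraph.isAcyclic_sup_fromEdgeSet_iff]
  simp [Acyc, Conn, h]

theorem conn_insert {S : Set (Sym2 V)} {u v c d : V} :
    Conn (insert s(u, v) S) c d ↔
      Conn S c d ∨ (Conn S c u ∧ Conn S v d ∨ Conn S c v ∧ Conn S u d) := by
  have h1 : Conn ({s(u, v)} : Set (Sym2 V)) u v := Conn.of_mem rfl
  rw [Set.insert_eq, Set.union_comm,
    conn_union_same (U := Set.univ) (W := {u, v}) (p := u) (q := v)]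
  · simp [h1]
  · intro e _ v _; trivial
  · rintro e rfl w hw; simpa using hw
  · intro w _ hw; simpa using hw
  · trivial
  · trivial

theorem conn_empty {u v : V} : Conn (∅ : Set (Sym2 V)) u v ↔ u = v := by
  constructor
  · intro h
    exact Conn.induction (P := fun v => u = v) rfl (fun _ _ h => h.elim) h
  · rintro rfl; exact Conn.refl _ _

theorem acyc_empty : Acyc (∅ : Set (Sym2 V)) := by
  simp [Acyc]

/-- A cycle using both pieces must pass through p and q and so joins them on either side. The proof
adds the edges of T one at a time. The case p = q is the gluing at a single vertex, which creates no
cycle. -/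
theorem acyc_union {S T : Set (Sym2 V)} {U W : Set V} {p q : V} (hfin : T.Finite)
    (hS : SuppIn S U) (hT : SuppIn T W) (hUW : ∀ v ∈ U, v ∈ W → v = p ∨ v = q)
    (hdis : Disjoint S T) :
    Acyc (S ∪ T) ↔ Acyc S ∧ Acyc T ∧ (Conn S p q → Conn T p q → p = q) := by
  induction T, hfin using Set.Finite.induction_on with
  | empty => simp [acyc_empty, conn_empty]
  | @insert e T he _ ih =>
    induction e with
    | h u v =>
    have hT' : SuppIn T W := fun e he => hT e (Set.mem_insert_of_mem _ he)
    have hd' : Disjoint S T := hdis.mono_right (Set.subset_insert _ _)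
    have hu : u ∈ W := hT _ (Set.mem_insert _ _) u (by simp)
    have hv : v ∈ W := hT _ (Set.mem_insert _ _) v (by simp)
    have heS : s(u, v) ∉ S := fun h => Set.disjoint_left.1 hdis h (Set.mem_insert _ _)
    -- The new edge closes a cycle iff its ends are already joined, within T or through S from p to
    -- q. What remains is propositional.
    rw [Set.union_insert, acyc_insert (by simp [heS, he]), acyc_insert he, ih hT' hd',
      conn_insert, Set.union_comm,
      conn_union_same hT' hS (fun w hw hU => hUW w hU hw) hu hv]
    by_cases hpq : p = q
    · subst hpq
      have := @Conn.trans _ T u p v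
      grind [Conn.refl]
    · by_cases huv : u = v
      · subst huv
        have := @Conn.trans _ T p u q
        grind
      · grind [Conn.comm (S := T)]

end Gluing

/-! ### Corner patterns and their composition law. -/

/-- Partitions of the three corners `o, a, b`: all together, one corner isolated, all separate. -/
inductive Pat
  | T | B | A | O | H
  deriving DecidableEq

instance : Fintype Pat := ⟨{.T, .B, .A, .O, .H}, by rintro ⟨⟩ <;> decide⟩

/-- `o` and `a` are in the same block. -/
def Pat.oa : Pat → Bool
  | .T => true | .B => true | .A => false | .O => false | .H => false

/-- `o` and `b` are in the same block. -/
def Pat.ob : Pat → Bool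
  | .T => true | .B => false | .A => true | .O => false | .H => false

/-- `a` and `b` are in the same block. -/
def Pat.ab : Pat → Bool
  | .T => true | .B => false | .A => false | .O => true | .H => false

theorem Pat.ext_of {p q : Pat} (h1 : p.oa = q.oa) (h2 : p.ob = q.ob) (h3 : p.ab = q.ab) :
    p = q := by
  revert p q; decide

/-- The pattern with the given connections, junk when they are not transitive. -/
def Pat.ofBools : Bool → Bool → Bool → Pat
  | true, true, _ => .T
  | true, false, _ => .B
  | false, true, _ => .A
  | false, false, true => .O
  | false, false, false => .H

/-- The pattern of a union of three forests placed on the three triangles of the stage-one gasket,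
`none` if there is a cycle or a component without corner. -/
def Pat.comb (p q r : Pat) : Option Pat :=
  -- The junctions are x, y, z: the pieces have corners (o, x, y), (x, a, z) and (y, z, b). The
  -- conditions below forbid the cycle through x, y, z and ask that each junction reach an outer
  -- corner.
  let ox := p.oa; let oy := p.ob; let xy := p.ab
  let xa := q.oa; let xz := q.ob; let az := q.ab
  let yz := r.oa; let yb := r.ob; let zb := r.ab
  if !(xy && xz && yz) &&
    (ox || xa || (xy && yb) || (xz && zb) || (xz && yz && oy) || (xy && yz && az)) &&
    (oy || yb || (xy && xa) || (yz && az) || (yz && xz && ox) || (xy && xz && zb)) &&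
    (az || zb || (xz && ox) || (yz && oy) || (xz && xy && yb) || (yz && xy && xa))
  then some (Pat.ofBools ((ox && xa) || (oy && yz && az)) ((oy && yb) || (ox && xz && zb))
    ((az && zb) || (xa && xy && yb)))
  else none

-- The right-hand side has the shape produced in `isForest_glue` by attaching the third piece to the
-- union of the first two. There are only 5⁴ cases to check.
set_option maxRecDepth 10000 in
set_option synthInstance.maxHeartbeats 400000 in
set_option synthInstance.maxSize 10000 in
theorem Pat.comb_eq_some_iff (p₁ p₂ p₃ p : Pat) : Pat.comb p₁ p₂ p₃ = some p ↔
    (p₁.ab ∧ p₂.ob → p₃.oa → False) ∧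
    ((p₁.oa ∨ p₃.oa ∧ (p₁.ab ∧ p₁.oa ∧ p₂.ob ∨ p₂.ob ∧ p₁.ob)) ∨
      (p₂.oa ∨ p₃.oa ∧ (p₁.ab ∧ p₂.ab ∨ p₂.ob ∧ p₁.ab ∧ p₂.oa)) ∨
      p₁.ab ∧ p₃.ob ∨ p₂.ob ∧ p₃.ab) ∧
    ((p₁.ob ∨ p₃.oa ∧ (p₁.oa ∧ p₂.ob ∨ (p₁.ab ∧ p₂.ob) ∧ p₁.ob)) ∨
      (p₁.ab ∧ p₂.oa ∨ p₃.oa ∧ (p₂.ab ∨ (p₁.ab ∧ p₂.ob) ∧ p₁.ab ∧ p₂.oa)) ∨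
      p₃.ob ∨ (p₁.ab ∧ p₂.ob) ∧ p₃.ab) ∧
    ((p₁.oa ∧ p₂.ob ∨ p₃.oa ∧ ((p₁.ab ∧ p₂.ob) ∧ p₁.oa ∧ p₂.ob ∨ p₁.ob)) ∨
      (p₂.ab ∨ p₃.oa ∧ ((p₁.ab ∧ p₂.ob) ∧ p₂.ab ∨ p₁.ab ∧ p₂.oa)) ∨
      (p₁.ab ∧ p₂.ob) ∧ p₃.ob ∨ p₃.ab) ∧
    (p₁.oa ∧ p₂.oa ∨ p₃.oa ∧ (p₁.ob ∧ p₂.ab ∨ (p₁.oa ∧ p₂.ob) ∧ p₁.ab ∧ p₂.oa) ↔ p.oa) ∧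
    (p₁.ob ∧ p₃.ob ∨ (p₁.oa ∧ p₂.ob) ∧ p₃.ab ↔ p.ob) ∧
    ((p₁.ab ∧ p₂.oa) ∧ p₃.ob ∨ p₂.ab ∧ p₃.ab ↔ p.ab) := by
  revert p₁ p₂ p₃ p
  decide

section Patterns

variable {V : Type*}

/-- `S` induces the partition `p` on the corners `o, a, b`. -/
def HasPat (S : Set (Sym2 V)) (o a b : V) (p : Pat) : Prop :=
  (Conn S o a ↔ p.oa) ∧ (Conn S o b ↔ p.ob) ∧ (Conn S a b ↔ p.ab)

theorem exists_hasPat (S : Set (Sym2 V)) (o a b : V) : ∃ p, HasPat S o a b p := by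
  by_cases h1 : Conn S o a <;> by_cases h2 : Conn S o b <;> by_cases h3 : Conn S a b
  · exact ⟨.T, by simp [HasPat, Pat.oa, Pat.ob, Pat.ab, *]⟩
  · exact absurd (h1.symm.trans h2) h3
  · exact absurd (h1.trans h3) h2
  · exact ⟨.B, by simp [HasPat, Pat.oa, Pat.ob, Pat.ab, *]⟩
  · exact absurd (h2.trans h3.symm) h1
  · exact ⟨.A, by simp [HasPat, Pat.oa, Pat.ob, Pat.ab, *]⟩
  · exact ⟨.O, by simp [HasPat, Pat.oa, Pat.ob, Pat.ab, *]⟩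
  · exact ⟨.H, by simp [HasPat, Pat.oa, Pat.ob, Pat.ab, *]⟩

theorem HasPat.unique {S : Set (Sym2 V)} {o a b : V} {p q : Pat} (hp : HasPat S o a b p)
    (hq : HasPat S o a b q) : p = q := by
  obtain ⟨h1, h2, h3⟩ := hp
  obtain ⟨k1, k2, k3⟩ := hq
  exact Pat.ext_of (Bool.eq_iff_iff.2 (h1.symm.trans k1)) (Bool.eq_iff_iff.2 (h2.symm.trans k2))
    (Bool.eq_iff_iff.2 (h3.symm.trans k3))

/-- Every vertex of `W` is connected to one of the corners. -/
def Covers (S : Set (Sym2 V)) (W : Set V) (o a b : V) : Prop :=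
  ∀ v ∈ W, Conn S v o ∨ Conn S v a ∨ Conn S v b

/-- `S` is a forest on `W`, each tree of which contains a corner, with partition `p` of the
corners. -/
def IsForest (S : Set (Sym2 V)) (W : Set V) (o a b : V) (p : Pat) : Prop :=
  Acyc S ∧ Covers S W o a b ∧ HasPat S o a b p

theorem IsForest.unique {S : Set (Sym2 V)} {W : Set V} {o a b : V} {p q : Pat}
    (hp : IsForest S W o a b p) (hq : IsForest S W o a b q) : p = q :=
  hp.2.2.unique hq.2.2

/-- A path from inside a piece to a corner outside it must leave through p or q. -/
theorem covers_piece {S T : Set (Sym2 V)} {U W : Set V} {k p q a b : V} (hS : SuppIn S U)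
    (hT : SuppIn T W) (hUW : ∀ v ∈ U, v ∈ W → v = p ∨ v = q) (hk : k ∈ U) (ha : a ∈ W)
    (hb : b ∈ W) (h : ∀ v ∈ U, Conn (S ∪ T) v k ∨ Conn (S ∪ T) v a ∨ Conn (S ∪ T) v b) :
    ∀ v ∈ U, Conn S v k ∨ Conn S v p ∨ Conn S v q := by
  intro v hv
  rcases h v hv with h | h | h
  · exact h.exit_same hS hT hUW hv hk
  · exact Or.inr (h.exit hS hT hUW hv ha)
  · exact Or.inr (h.exit hS hT hUW hv hb)

section ThreePieces

variable {S₁ S₂ S₃ : Set (Sym2 V)} {V₁ V₂ V₃ : Set V} {o x y a z b : V}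

/-- The global covering condition localises to the pieces, up to the three junctions, whose covering
is a matter of patterns only. -/
theorem covers_glue (h₁ : SuppIn S₁ V₁) (h₂ : SuppIn S₂ V₂) (h₃ : SuppIn S₃ V₃)
    (h₁₂ : ∀ v ∈ V₁, v ∈ V₂ → v = x) (h₁₃ : ∀ v ∈ V₁, v ∈ V₃ → v = y)
    (h₂₃ : ∀ v ∈ V₂, v ∈ V₃ → v = z) (ho : o ∈ V₁) (hx₁ : x ∈ V₁) (hy₁ : y ∈ V₁)
    (ha : a ∈ V₂) (hz₂ : z ∈ V₂) (hb : b ∈ V₃) :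
    Covers (S₁ ∪ S₂ ∪ S₃) (V₁ ∪ V₂ ∪ V₃) o a b ↔
      Covers S₁ V₁ o x y ∧ Covers S₂ V₂ x a z ∧ Covers S₃ V₃ y z b ∧
        Covers (S₁ ∪ S₂ ∪ S₃) {x, y, z} o a b := by
  constructor
  · intro h
    refine ⟨?_, ?_, ?_, ?_⟩
    · refine covers_piece (T := S₂ ∪ S₃) (W := V₂ ∪ V₃) (a := a) (b := b) h₁ (h₂.union h₃) ?_ ho
        (Or.inl ha) (Or.inr hb) ?_
      · rintro v hv (hw | hw)
        · exact Or.inl (h₁₂ v hv hw)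
        · exact Or.inr (h₁₃ v hv hw)
      · intro v hv
        rw [← Set.union_assoc]
        exact h v (Or.inl (Or.inl hv))
    · intro v hv
      have := covers_piece (S := S₂) (T := S₁ ∪ S₃) (U := V₂) (W := V₁ ∪ V₃) (k := a) (p := x)
        (q := z) (a := o) (b := b) h₂ (h₁.union h₃) ?_ ha
        (Or.inl ho) (Or.inr hb) ?_ v hv
      · tauto
      · rintro v hv (hw | hw)
        · exact Or.inl (h₁₂ v hw hv)
        · exact Or.inr (h₂₃ v hv hw)
      · intro v hv
        rw [← Set.union_assoc, Set.union_comm S₂]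
        have := h v (Or.inl (Or.inr hv))
        tauto
    · intro v hv
      have := covers_piece (S := S₃) (T := S₁ ∪ S₂) (U := V₃) (W := V₁ ∪ V₂) (k := b) (p := y)
        (q := z) (a := o) (b := a) h₃ (h₁.union h₂) ?_ hb
        (Or.inl ho) (Or.inr ha) ?_ v hv
      · tauto
      · rintro v hv (hw | hw)
        · exact Or.inl (h₁₃ v hw hv)
        · exact Or.inr (h₂₃ v hw hv)
      · intro v hv
        rw [Set.union_comm S₃]
        have := h v (Or.inr hv)
        tauto
    · rintro v (rfl | rfl | rfl)
      · exact h _ (Or.inl (Or.inl hx₁))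
      · exact h _ (Or.inl (Or.inl hy₁))
      · exact h _ (Or.inl (Or.inr hz₂))
  · rintro ⟨c₁, c₂, c₃, c⟩
    set S := S₁ ∪ S₂ ∪ S₃ with hSdef
    have m₁ : ∀ {u v}, Conn S₁ u v → Conn S u v := Conn.mono (by grind)
    have m₂ : ∀ {u v}, Conn S₂ u v → Conn S u v := Conn.mono (by grind)
    have m₃ : ∀ {u v}, Conn S₃ u v → Conn S u v := Conn.mono (by grind)
    have via : ∀ {v t}, Conn S v t → t ∈ ({x, y, z} : Set V) →
        Conn S v o ∨ Conn S v a ∨ Conn S v b := by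
      intro v t h ht
      exact (c t ht).imp h.trans (Or.imp h.trans h.trans)
    rintro v ((hv | hv) | hv)
    · rcases c₁ v hv with h | h | h
      · exact Or.inl (m₁ h)
      · exact via (m₁ h) (by simp)
      · exact via (m₁ h) (by simp)
    · rcases c₂ v hv with h | h | h
      · exact via (m₂ h) (by simp)
      · exact Or.inr (Or.inl (m₂ h))
      · exact via (m₂ h) (by simp)
    · rcases c₃ v hv with h | h | h
      · exact via (m₃ h) (by simp)
      · exact via (m₃ h) (by simp)
      · exact Or.inr (Or.inr (m₃ h))

/-- The first two pieces are glued at the single vertex x, then the third at the two vertices y and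
z. Every remaining condition concerns connections between corners and junctions, hence only the
patterns of the pieces. -/
theorem isForest_glue (hfin₂ : S₂.Finite) (hfin₃ : S₃.Finite)
    (h₁ : SuppIn S₁ V₁) (h₂ : SuppIn S₂ V₂) (h₃ : SuppIn S₃ V₃)
    (h₁₂ : ∀ v ∈ V₁, v ∈ V₂ → v = x) (h₁₃ : ∀ v ∈ V₁, v ∈ V₃ → v = y)
    (h₂₃ : ∀ v ∈ V₂, v ∈ V₃ → v = z) (ho : o ∈ V₁) (hx₁ : x ∈ V₁) (hx₂ : x ∈ V₂) (hy₁ : y ∈ V₁)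
    (ha : a ∈ V₂) (hz₂ : z ∈ V₂) (hb : b ∈ V₃) (hyz : y ≠ z)
    (d₁₂ : Disjoint S₁ S₂) (d₁₃ : Disjoint S₁ S₃) (d₂₃ : Disjoint S₂ S₃) (p : Pat) :
    IsForest (S₁ ∪ S₂ ∪ S₃) (V₁ ∪ V₂ ∪ V₃) o a b p ↔
      ∃ p₁ p₂ p₃, IsForest S₁ V₁ o x y p₁ ∧ IsForest S₂ V₂ x a z p₂ ∧ IsForest S₃ V₃ y z b p₃ ∧
        Pat.comb p₁ p₂ p₃ = some p := by
  obtain ⟨p₁, P₁⟩ := exists_hasPat S₁ o x y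
  obtain ⟨p₂, P₂⟩ := exists_hasPat S₂ x a z
  obtain ⟨p₃, P₃⟩ := exists_hasPat S₃ y z b
  have hm : ∀ v ∈ V₁, v ∈ V₂ → v = x ∨ v = x := fun v h h' => Or.inl (h₁₂ v h h')
  have hm' : ∀ v ∈ V₁ ∪ V₂, v ∈ V₃ → v = y ∨ v = z := by
    rintro v (h | h) h'
    · exact Or.inl (h₁₃ v h h')
    · exact Or.inr (h₂₃ v h h')
  have R : (∃ p₁ p₂ p₃, IsForest S₁ V₁ o x y p₁ ∧ IsForest S₂ V₂ x a z p₂ ∧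
      IsForest S₃ V₃ y z b p₃ ∧ Pat.comb p₁ p₂ p₃ = some p) ↔
      (Acyc S₁ ∧ Acyc S₂ ∧ Acyc S₃) ∧
      (Covers S₁ V₁ o x y ∧ Covers S₂ V₂ x a z ∧ Covers S₃ V₃ y z b) ∧
      Pat.comb p₁ p₂ p₃ = some p := by
    constructor
    · rintro ⟨q₁, q₂, q₃, f₁, f₂, f₃, h⟩
      rw [P₁.unique f₁.2.2, P₂.unique f₂.2.2, P₃.unique f₃.2.2]
      exact ⟨⟨f₁.1, f₂.1, f₃.1⟩, ⟨f₁.2.1, f₂.2.1, f₃.2.1⟩, h⟩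
    · rintro ⟨⟨a₁, a₂, a₃⟩, ⟨c₁, c₂, c₃⟩, h⟩
      exact ⟨p₁, p₂, p₃, ⟨a₁, c₁, P₁⟩, ⟨a₂, c₂, P₂⟩, ⟨a₃, c₃, P₃⟩, h⟩
  rw [R, IsForest, covers_glue h₁ h₂ h₃ h₁₂ h₁₃ h₂₃ ho hx₁ hy₁ ha hz₂ hb,
    acyc_union hfin₃ (h₁.union h₂) h₃ hm' (Set.disjoint_union_left.2 ⟨d₁₃, d₂₃⟩),
    acyc_union hfin₂ h₁ h₂ hm d₁₂]
  -- With the single contact x, an excursion into the other piece returns to where it left.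
  have s1 : ∀ {u w}, u ∈ V₁ → w ∈ V₁ → (Conn (S₁ ∪ S₂) u w ↔ Conn S₁ u w) := by
    intro u w hu hw
    rw [conn_union_same h₁ h₂ hm hu hw]
    have := @Conn.trans _ S₁ u x w
    tauto
  have s2 : ∀ {u w}, u ∈ V₂ → w ∈ V₂ → (Conn (S₁ ∪ S₂) u w ↔ Conn S₂ u w) := by
    intro u w hu hw
    rw [Set.union_comm, conn_union_same h₂ h₁ (fun v h h' => hm v h' h) hu hw]
    have := @Conn.trans _ S₂ u x w
    tauto
  have s12 : ∀ {u w}, u ∈ V₁ → w ∈ V₂ → (Conn (S₁ ∪ S₂) u w ↔ Conn S₁ u x ∧ Conn S₂ x w) := by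
    intro u w hu hw
    rw [conn_union_cross h₁ h₂ hm hu hw, or_self]
  have s21 : ∀ {u w}, u ∈ V₂ → w ∈ V₁ → (Conn (S₁ ∪ S₂) u w ↔ Conn S₁ w x ∧ Conn S₂ x u) := by
    intro u w hu hw
    rw [Conn.comm, s12 hw hu]
  have t12 : ∀ {u w}, u ∈ V₁ ∪ V₂ → w ∈ V₁ ∪ V₂ → _ :=
    fun {u w} hu hw => conn_union_same (h₁.union h₂) h₃ hm' hu hw
  have t3 : ∀ {u w}, u ∈ V₁ ∪ V₂ → w ∈ V₃ → _ :=
    fun {u w} hu hw => conn_union_cross (h₁.union h₂) h₃ hm' hu hw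
  have ho' : o ∈ V₁ ∪ V₂ := Or.inl ho
  have hx' : x ∈ V₁ ∪ V₂ := Or.inl hx₁
  have hy' : y ∈ V₁ ∪ V₂ := Or.inl hy₁
  have ha' : a ∈ V₁ ∪ V₂ := Or.inr ha
  have hz' : z ∈ V₁ ∪ V₂ := Or.inr hz₂
  obtain ⟨e1, e2, e3⟩ := P₁
  obtain ⟨e4, e5, e6⟩ := P₂
  obtain ⟨e7, e8, e9⟩ := P₃
  have e1' := Conn.comm.trans e1
  have e2' := Conn.comm.trans e2
  have e3' := Conn.comm.trans e3
  have e4' := Conn.comm.trans e4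
  have e5' := Conn.comm.trans e5
  have e6' := Conn.comm.trans e6
  have e7' := Conn.comm.trans e7
  have e8' := Conn.comm.trans e8
  have e9' := Conn.comm.trans e9
  have rf : ∀ (S : Set (Sym2 V)) u, Conn S u u ↔ True := fun S u => iff_true_intro (Conn.refl S u)
  have hcov : ∀ S : Set (Sym2 V), Covers S {x, y, z} o a b ↔
      (Conn S x o ∨ Conn S x a ∨ Conn S x b) ∧ (Conn S y o ∨ Conn S y a ∨ Conn S y b) ∧
        (Conn S z o ∨ Conn S z a ∨ Conn S z b) := fun S => by
    simp only [Covers, Set.mem_insert_iff, Set.mem_singleton_iff, forall_eq_or_imp, forall_eq]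
  rw [hcov, HasPat]
  simp only [t12 hx' ho', t12 hy' ho', t12 hz' ho', t12 hx' ha', t12 hy' ha', t12 hz' ha',
    t3 hx' hb, t3 hy' hb, t3 hz' hb, t12 ho' ha', t3 ho' hb, t3 ha' hb,
    s1 hx₁ ho, s1 hx₁ hy₁, s1 hy₁ ho, s1 ho hy₁, s1 hy₁ hy₁,
    s2 hx₂ ha, s2 hx₂ hz₂, s2 ha hz₂, s2 hz₂ ha, s2 hz₂ hz₂,
    s12 ho ha, s12 ho hz₂, s12 hy₁ ha, s12 hy₁ hz₂, s21 hz₂ ho, s21 ha hy₁, s21 hz₂ hy₁,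
    e1, e2, e3, e4, e5, e6, e7, e8, e9, e1', e2', e3', e6', rf, hyz, true_and, forall_const]
  rw [Pat.comb_eq_some_iff]
  constructor
  · rintro ⟨⟨⟨a₁, a₂, -⟩, a₃, k₁⟩, ⟨c₁, c₂, c₃, k₂, k₃, k₄⟩, k⟩
    exact ⟨⟨a₁, a₂, a₃⟩, ⟨c₁, c₂, c₃⟩, k₁, k₂, k₃, k₄, k⟩
  · rintro ⟨⟨a₁, a₂, a₃⟩, ⟨c₁, c₂, c₃⟩, k₁, k₂, k₃, k₄, k⟩
    exact ⟨⟨⟨a₁, a₂, trivial⟩, a₃, k₁⟩, ⟨c₁, c₂, c₃, k₂, k₃, k₄⟩, k⟩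

end ThreePieces

end Patterns

/-! ### Invariance under injective maps of the vertices. -/

section Transport

variable {V V' : Type*} {f : V → V'}

theorem conn_image (hf : f.Injective) {S : Set (Sym2 V)} {u v : V} :
    Conn (Sym2.map f '' S) (f u) (f v) ↔ Conn S u v := by
  constructor
  · intro h
    have := Conn.induction (P := fun w => ∃ v, f v = w ∧ Conn S u v) ⟨u, rfl, Conn.refl S u⟩ ?_ h
    · obtain ⟨v', hv', h'⟩ := this
      exact hf hv' ▸ h'
    · rintro _ w' ⟨e, he, hew⟩ ⟨v, rfl, hv⟩
      have hmem : f v ∈ Sym2.map f e := hew ▸ by simp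
      have hmem' : w' ∈ Sym2.map f e := hew ▸ by simp
      obtain ⟨v₁, hv₁, h₁⟩ := Sym2.mem_map.1 hmem
      obtain ⟨w, -, rfl⟩ := Sym2.mem_map.1 hmem'
      have : e = s(v, w) := Sym2.map.injective hf (by rw [hew, Sym2.map_mk])
      exact ⟨w, rfl, hv.trans (Conn.of_mem (this ▸ he))⟩
  · intro h
    refine Conn.induction (P := fun v => Conn (Sym2.map f '' S) (f u) (f v)) (Conn.refl _ _) ?_ h
    intro v w hvw hv
    exact hv.trans (Conn.of_mem ⟨_, hvw, Sym2.map_mk _ _ _⟩)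

theorem acyc_image (hf : f.Injective) {S : Set (Sym2 V)} (hS : S.Finite) :
    Acyc (Sym2.map f '' S) ↔ Acyc S := by
  induction S, hS using Set.Finite.induction_on with
  | empty => simp [acyc_empty]
  | @insert e T he _ ih =>
    induction e with
    | h u v =>
    have he' : s(f u, f v) ∉ Sym2.map f '' T := by
      rintro ⟨e', he', h⟩
      rw [← Sym2.map_mk] at h
      exact he (Sym2.map.injective hf h ▸ he')
    rw [Set.image_insert_eq, Sym2.map_mk, acyc_insert he', acyc_insert he, ih, conn_image hf,
      hf.eq_iff]

theorem isForest_image (hf : f.Injective) {S : Set (Sym2 V)} (hS : S.Finite) {W : Set V}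
    {o a b : V} {p : Pat} :
    IsForest (Sym2.map f '' S) (f '' W) (f o) (f a) (f b) p ↔ IsForest S W o a b p := by
  simp [IsForest, Covers, HasPat, acyc_image hf hS, conn_image hf]

end Transport

/-! ### The three copies of SG(n) inside SG(n+1). -/

/-- Translation of the lower-left copy of `SG(n)` to the lower-right one. -/
def shiftA (n : ℕ) : ℕ × ℕ ↪ ℕ × ℕ :=
  ⟨fun p => (p.1 + 2 ^ n, p.2), fun p q h => by
    simp only [Prod.mk.injEq] at h; ext <;> omega⟩

/-- Translation of the lower-left copy of `SG(n)` to the top one. -/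
def shiftB (n : ℕ) : ℕ × ℕ ↪ ℕ × ℕ :=
  ⟨fun p => (p.1, p.2 + 2 ^ n), fun p q h => by
    simp only [Prod.mk.injEq] at h; ext <;> omega⟩

theorem shiftA_apply (n : ℕ) (p : ℕ × ℕ) : shiftA n p = (p.1 + 2 ^ n, p.2) := rfl

theorem shiftB_apply (n : ℕ) (p : ℕ × ℕ) : shiftB n p = (p.1, p.2 + 2 ^ n) := rfl

theorem coe_verts_succ (n : ℕ) : (verts (n + 1) : Set (ℕ × ℕ)) =
    ↑(verts n) ∪ shiftA n '' ↑(verts n) ∪ shiftB n '' ↑(verts n) := by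
  simp [verts, Set.union_assoc]; rfl

theorem coe_edges_succ (n : ℕ) : (edges (n + 1) : Set (Sym2 (ℕ × ℕ))) =
    ↑(edges n) ∪ Sym2.map (shiftA n) '' ↑(edges n) ∪ Sym2.map (shiftB n) '' ↑(edges n) := by
  simp [edges, Set.union_assoc]; rfl

theorem mem_edges_succ {n : ℕ} {e : Sym2 (ℕ × ℕ)} : e ∈ edges (n + 1) ↔
    e ∈ edges n ∨ (∃ e' ∈ edges n, Sym2.map (shiftA n) e' = e) ∨
      ∃ e' ∈ edges n, Sym2.map (shiftB n) e' = e := by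
  rw [← Finset.mem_coe, coe_edges_succ]
  simp [or_assoc]

theorem add_le_of_mem_verts {n : ℕ} : ∀ {v : ℕ × ℕ}, v ∈ verts n → v.1 + v.2 ≤ 2 ^ n := by
  induction n with
  | zero => simp [verts]
  | succ n ih =>
    intro v hv
    rw [← Finset.mem_coe, coe_verts_succ] at hv
    rcases hv with (hv | ⟨w, hw, rfl⟩) | ⟨w, hw, rfl⟩
    · have := ih hv; omega
    · have := ih hw; simp only [shiftA_apply]; omega
    · have := ih hw; simp only [shiftB_apply]; omega

theorem suppIn_image {V V' : Type*} (f : V → V') {S : Set (Sym2 V)} {W : Set V}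
    (h : SuppIn S W) : SuppIn (Sym2.map f '' S) (f '' W) := by
  rintro _ ⟨e, he, rfl⟩ v hv
  obtain ⟨w, hw, rfl⟩ := Sym2.mem_map.1 hv
  exact ⟨w, h e he w hw, rfl⟩

theorem suppIn_edges (n : ℕ) : SuppIn (edges n : Set (Sym2 (ℕ × ℕ))) (verts n) := by
  induction n with
  | zero =>
    intro e he v hv
    simp only [edges, Finset.coe_insert, Finset.coe_singleton, Set.mem_insert_iff,
      Set.mem_singleton_iff] at he
    rcases he with rfl | rfl | rfl <;> rcases Sym2.mem_iff.1 hv with rfl | rfl <;> simp [verts]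
  | succ n ih =>
    rw [coe_edges_succ, coe_verts_succ]
    exact (ih.union (suppIn_image _ ih)).union (suppIn_image _ ih)

theorem not_isDiag_of_mem_edges {n : ℕ} : ∀ {e}, e ∈ edges n → ¬ e.IsDiag := by
  induction n with
  | zero => simp [edges]
  | succ n ih =>
    intro e he
    rcases mem_edges_succ.1 he with h | ⟨e', h, rfl⟩ | ⟨e', h, rfl⟩
    · exact ih h
    · rw [Sym2.isDiag_map (shiftA n).injective]; exact ih h
    · rw [Sym2.isDiag_map (shiftB n).injective]; exact ih h

theorem meet_left_right {n : ℕ} : ∀ v ∈ (verts n : Set (ℕ × ℕ)),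
    v ∈ shiftA n '' (verts n : Set (ℕ × ℕ)) → v = a n := by
  rintro v hv ⟨w, hw, rfl⟩
  have h1 := add_le_of_mem_verts hv
  simp only [shiftA_apply, a, Prod.mk.injEq] at *
  omega

theorem meet_left_top {n : ℕ} : ∀ v ∈ (verts n : Set (ℕ × ℕ)),
    v ∈ shiftB n '' (verts n : Set (ℕ × ℕ)) → v = b n := by
  rintro v hv ⟨w, hw, rfl⟩
  have h1 := add_le_of_mem_verts hv
  simp only [shiftB_apply, b, Prod.mk.injEq] at *
  omega

theorem meet_right_top {n : ℕ} : ∀ v ∈ shiftA n '' (verts n : Set (ℕ × ℕ)),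
    v ∈ shiftB n '' (verts n : Set (ℕ × ℕ)) → v = c n := by
  rintro _ ⟨u, hu, rfl⟩ ⟨w, hw, h⟩
  have h1 := add_le_of_mem_verts hu
  have h2 := add_le_of_mem_verts hw
  simp only [shiftA_apply, shiftB_apply, c, Prod.mk.injEq] at *
  omega

/-- Both ends of a common edge would be x, making it a loop. -/
theorem disjoint_of_suppIn {V : Type*} {S T : Set (Sym2 V)} {U W : Set V} {x : V}
    (hS : SuppIn S U) (hT : SuppIn T W) (hUW : ∀ v ∈ U, v ∈ W → v = x)
    (hd : ∀ e ∈ S, ¬ e.IsDiag) : Disjoint S T := by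
  rw [Set.disjoint_left]
  intro e heS heT
  refine hd e heS ?_
  induction e with
  | h u v =>
    have h1 := hUW u (hS _ heS u (by simp)) (hT _ heT u (by simp))
    have h2 := hUW v (hS _ heS v (by simp)) (hT _ heT v (by simp))
    simp [h1, h2]

theorem disjoint_left_right (n : ℕ) :
    Disjoint (edges n : Set (Sym2 (ℕ × ℕ))) (Sym2.map (shiftA n) '' ↑(edges n)) :=
  disjoint_of_suppIn (suppIn_edges n) (suppIn_image _ (suppIn_edges n)) meet_left_right
    fun _ => not_isDiag_of_mem_edges

theorem disjoint_left_top (n : ℕ) :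
    Disjoint (edges n : Set (Sym2 (ℕ × ℕ))) (Sym2.map (shiftB n) '' ↑(edges n)) :=
  disjoint_of_suppIn (suppIn_edges n) (suppIn_image _ (suppIn_edges n)) meet_left_top
    fun _ => not_isDiag_of_mem_edges

theorem disjoint_right_top (n : ℕ) :
    Disjoint (Sym2.map (shiftA n) '' (edges n : Set (Sym2 (ℕ × ℕ))))
      (Sym2.map (shiftB n) '' ↑(edges n)) :=
  disjoint_of_suppIn (suppIn_image _ (suppIn_edges n)) (suppIn_image _ (suppIn_edges n))
    meet_right_top (by
      rintro _ ⟨e, he, rfl⟩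
      rw [Sym2.isDiag_map (shiftA n).injective]
      exact not_isDiag_of_mem_edges he)

/-- The subgraph of `SG(n + 1)` made of the given subgraphs of the three copies of `SG(n)`. -/
def glue (n : ℕ) (S₁ S₂ S₃ : Finset (Sym2 (ℕ × ℕ))) : Finset (Sym2 (ℕ × ℕ)) :=
  S₁ ∪ S₂.map (shiftA n).sym2Map ∪ S₃.map (shiftB n).sym2Map

theorem coe_glue (n : ℕ) (S₁ S₂ S₃ : Finset (Sym2 (ℕ × ℕ))) :
    (glue n S₁ S₂ S₃ : Set (Sym2 (ℕ × ℕ))) =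
      ↑S₁ ∪ Sym2.map (shiftA n) '' ↑S₂ ∪ Sym2.map (shiftB n) '' ↑S₃ := by
  simp [glue, Set.union_assoc]

/-- `S` is a spanning forest of `SG(n)`, each tree of which contains a corner, with partition `p`
of the corners. -/
def IsF (n : ℕ) (p : Pat) (S : Finset (Sym2 (ℕ × ℕ))) : Prop :=
  IsForest (S : Set (Sym2 (ℕ × ℕ))) (verts n) o (a n) (b n) p

theorem shiftA_o (n : ℕ) : shiftA n o = a n := by simp [shiftA_apply, o, a]
theorem shiftA_a (n : ℕ) : shiftA n (a n) = a (n + 1) := by simp [shiftA_apply, a]; ring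
theorem shiftA_b (n : ℕ) : shiftA n (b n) = c n := by simp [shiftA_apply, b, c]
theorem shiftB_o (n : ℕ) : shiftB n o = b n := by simp [shiftB_apply, o, b]
theorem shiftB_a (n : ℕ) : shiftB n (a n) = c n := by simp [shiftB_apply, a, c]
theorem shiftB_b (n : ℕ) : shiftB n (b n) = b (n + 1) := by simp [shiftB_apply, b]; ring

theorem isF_glue {n : ℕ} {S₁ S₂ S₃ : Finset (Sym2 (ℕ × ℕ))} (h₁ : S₁ ⊆ edges n)
    (h₂ : S₂ ⊆ edges n) (h₃ : S₃ ⊆ edges n) (p : Pat) :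
    IsF (n + 1) p (glue n S₁ S₂ S₃) ↔
      ∃ p₁ p₂ p₃, IsF n p₁ S₁ ∧ IsF n p₂ S₂ ∧ IsF n p₃ S₃ ∧ Pat.comb p₁ p₂ p₃ = some p := by
  have c₁ : (S₁ : Set (Sym2 (ℕ × ℕ))) ⊆ edges n := Finset.coe_subset.2 h₁
  have c₂ : Sym2.map (shiftA n) '' (S₂ : Set (Sym2 (ℕ × ℕ))) ⊆ Sym2.map (shiftA n) '' (edges n) :=
    Set.image_mono (Finset.coe_subset.2 h₂)
  have c₃ : Sym2.map (shiftB n) '' (S₃ : Set (Sym2 (ℕ × ℕ))) ⊆ Sym2.map (shiftB n) '' (edges n) :=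
    Set.image_mono (Finset.coe_subset.2 h₃)
  rw [IsF, coe_glue, coe_verts_succ, isForest_glue (x := a n) (y := b n) (z := c n)
    ((Finset.finite_toSet _).image _) ((Finset.finite_toSet _).image _)
    (fun e he => suppIn_edges n e (c₁ he))
    (fun e he => suppIn_image _ (suppIn_edges n) e (c₂ he))
    (fun e he => suppIn_image _ (suppIn_edges n) e (c₃ he))
    meet_left_right meet_left_top meet_right_top (o_mem n) (a_mem n)
    ⟨o, o_mem n, shiftA_o n⟩ (b_mem n) ⟨a n, a_mem n, shiftA_a n⟩ ⟨b n, b_mem n, shiftA_b n⟩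
    ⟨b n, b_mem n, shiftB_b n⟩ (by simp [b, c, (Nat.two_pow_pos n).ne])
    ((disjoint_left_right n).mono c₁ c₂) ((disjoint_left_top n).mono c₁ c₃)
    ((disjoint_right_top n).mono c₂ c₃)]
  have t₂ : ∀ q, IsForest (Sym2.map (shiftA n) '' (S₂ : Set (Sym2 (ℕ × ℕ))))
      (shiftA n '' (verts n : Set (ℕ × ℕ))) (a n) (a (n + 1)) (c n) q ↔ IsF n q S₂ := by
    intro q
    rw [IsF, ← isForest_image (shiftA n).injective S₂.finite_toSet, shiftA_o, shiftA_a, shiftA_b]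
  have t₃ : ∀ q, IsForest (Sym2.map (shiftB n) '' (S₃ : Set (Sym2 (ℕ × ℕ))))
      (shiftB n '' (verts n : Set (ℕ × ℕ))) (b n) (c n) (b (n + 1)) q ↔ IsF n q S₃ := by
    intro q
    rw [IsF, ← isForest_image (shiftB n).injective S₃.finite_toSet, shiftB_o, shiftB_a, shiftB_b]
  simp only [t₂, t₃, IsF]

/-- Edge sets of the copies are disjoint, so gluing is a bijection from triples of subgraphs; `m1`,
`m2`, `m3` recover the pieces. -/
theorem sum_powerset_edges_succ {M : Type*} [AddCommMonoid M] (n : ℕ)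
    (f : Finset (Sym2 (ℕ × ℕ)) → M) :
    ∑ S ∈ (edges (n + 1)).powerset, f S =
      ∑ S₁ ∈ (edges n).powerset, ∑ S₂ ∈ (edges n).powerset, ∑ S₃ ∈ (edges n).powerset,
        f (glue n S₁ S₂ S₃) := by
  simp only [← Finset.sum_product']
  have iA := Sym2.map.injective (shiftA n).injective
  have iB := Sym2.map.injective (shiftB n).injective
  have d12 : ∀ e ∈ edges n, ∀ e' ∈ edges n, Sym2.map (shiftA n) e' ≠ e := fun e he e' he' h =>
    Set.disjoint_left.1 (disjoint_left_right n) he ⟨e', he', h⟩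
  have d13 : ∀ e ∈ edges n, ∀ e' ∈ edges n, Sym2.map (shiftB n) e' ≠ e := fun e he e' he' h =>
    Set.disjoint_left.1 (disjoint_left_top n) he ⟨e', he', h⟩
  have d23 : ∀ e ∈ edges n, ∀ e' ∈ edges n, Sym2.map (shiftB n) e' ≠ Sym2.map (shiftA n) e :=
    fun e he e' he' h =>
      Set.disjoint_left.1 (disjoint_right_top n) ⟨e, he, rfl⟩ ⟨e', he', h⟩
  have mem : ∀ {e S₁ S₂ S₃}, e ∈ glue n S₁ S₂ S₃ ↔ e ∈ S₁ ∨
      (∃ e' ∈ S₂, Sym2.map (shiftA n) e' = e) ∨ ∃ e' ∈ S₃, Sym2.map (shiftB n) e' = e := by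
    intro e S₁ S₂ S₃
    simp [glue]
  have m1 : ∀ {S₁ S₂ S₃}, S₁ ⊆ edges n → S₂ ⊆ edges n → S₃ ⊆ edges n → ∀ e,
      e ∈ S₁ ↔ e ∈ edges n ∧ e ∈ glue n S₁ S₂ S₃ := by
    intro S₁ S₂ S₃ h₁ h₂ h₃ e
    refine ⟨fun h => ⟨h₁ h, mem.2 (Or.inl h)⟩, fun ⟨he, h⟩ => ?_⟩
    rcases mem.1 h with h | ⟨e', h, h'⟩ | ⟨e', h, h'⟩
    · exact h
    · exact absurd h' (d12 e he e' (h₂ h))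
    · exact absurd h' (d13 e he e' (h₃ h))
  have m2 : ∀ {S₁ S₂ S₃}, S₁ ⊆ edges n → S₂ ⊆ edges n → S₃ ⊆ edges n → ∀ e,
      e ∈ S₂ ↔ e ∈ edges n ∧ Sym2.map (shiftA n) e ∈ glue n S₁ S₂ S₃ := by
    intro S₁ S₂ S₃ h₁ h₂ h₃ e
    refine ⟨fun h => ⟨h₂ h, mem.2 (Or.inr (Or.inl ⟨e, h, rfl⟩))⟩, fun ⟨he, h⟩ => ?_⟩
    rcases mem.1 h with h | ⟨e', h, h'⟩ | ⟨e', h, h'⟩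
    · exact absurd rfl (d12 _ (h₁ h) e he)
    · exact iA h' ▸ h
    · exact absurd h' (d23 e he e' (h₃ h))
  have m3 : ∀ {S₁ S₂ S₃}, S₁ ⊆ edges n → S₂ ⊆ edges n → S₃ ⊆ edges n → ∀ e,
      e ∈ S₃ ↔ e ∈ edges n ∧ Sym2.map (shiftB n) e ∈ glue n S₁ S₂ S₃ := by
    intro S₁ S₂ S₃ h₁ h₂ h₃ e
    refine ⟨fun h => ⟨h₃ h, mem.2 (Or.inr (Or.inr ⟨e, h, rfl⟩))⟩, fun ⟨he, h⟩ => ?_⟩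
    rcases mem.1 h with h | ⟨e', h, h'⟩ | ⟨e', h, h'⟩
    · exact absurd rfl (d13 _ (h₁ h) e he)
    · exact absurd h'.symm (d23 e' (h₂ h) e he)
    · exact iB h' ▸ h
  symm
  refine Finset.sum_nbij (fun S => glue n S.1 S.2.1 S.2.2) ?_ ?_ ?_ (fun _ _ => rfl)
  · rintro ⟨S₁, S₂, S₃⟩ hS
    simp only [Finset.mem_product, Finset.mem_powerset] at hS ⊢
    intro e he
    obtain ⟨h₁, h₂, h₃⟩ := hS
    rcases mem.1 he with h | ⟨e', h, rfl⟩ | ⟨e', h, rfl⟩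
    · exact mem_edges_succ.2 (Or.inl (h₁ h))
    · exact mem_edges_succ.2 (Or.inr (Or.inl ⟨e', h₂ h, rfl⟩))
    · exact mem_edges_succ.2 (Or.inr (Or.inr ⟨e', h₃ h, rfl⟩))
  · rintro ⟨S₁, S₂, S₃⟩ hS ⟨T₁, T₂, T₃⟩ hT h
    simp only [Finset.mem_product, Finset.mem_powerset, Finset.mem_coe] at hS hT h
    obtain ⟨h₁, h₂, h₃⟩ := hS
    obtain ⟨k₁, k₂, k₃⟩ := hT
    simp only [Prod.mk.injEq]
    refine ⟨?_, ?_, ?_⟩ <;> ext e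
    · rw [m1 h₁ h₂ h₃, m1 k₁ k₂ k₃, h]
    · rw [m2 h₁ h₂ h₃, m2 k₁ k₂ k₃, h]
    · rw [m3 h₁ h₂ h₃, m3 k₁ k₂ k₃, h]
  · intro S hS
    rw [Finset.mem_coe, Finset.mem_powerset] at hS
    refine ⟨((edges n).filter (· ∈ S), (edges n).filter (Sym2.map (shiftA n) · ∈ S),
      (edges n).filter (Sym2.map (shiftB n) · ∈ S)), ?_, ?_⟩
    · simp only [Finset.mem_coe, Finset.mem_product, Finset.mem_powerset]
      exact ⟨Finset.filter_subset _ _, Finset.filter_subset _ _, Finset.filter_subset _ _⟩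
    · ext e
      simp only [mem, Finset.mem_filter]
      constructor
      · rintro (h | ⟨e', h, rfl⟩ | ⟨e', h, rfl⟩)
        · exact h.2
        · exact h.2
        · exact h.2
      · intro he
        rcases mem_edges_succ.1 (hS he) with h | ⟨e', h, rfl⟩ | ⟨e', h, rfl⟩
        · exact Or.inl ⟨h, he⟩
        · exact Or.inr (Or.inl ⟨e', ⟨h, he⟩, rfl⟩)
        · exact Or.inr (Or.inr ⟨e', ⟨h, he⟩, rfl⟩)

/-! ### Weighted counts by pattern and their recursion. -/

open Classical in
/-- Weighted number of the spanning forests of `SG(n)` with corner partition `p`. -/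
noncomputable def Z (n : ℕ) (p : Pat) (w : Finset (Sym2 (ℕ × ℕ)) → ℚ) : ℚ :=
  ∑ S ∈ (edges n).powerset, if IsF n p S then w S else 0

/-- The sum over triples of patterns combining to `p`. -/
def combSum (t₁ t₂ t₃ : Pat → ℚ) (p : Pat) : ℚ :=
  ∑ p₁, ∑ p₂, ∑ p₃, if Pat.comb p₁ p₂ p₃ = some p then t₁ p₁ * t₂ p₂ * t₃ p₃ else 0

theorem combSum_sum_first {ι : Type*} (s : Finset ι) (t : ι → Pat → ℚ) (u v : Pat → ℚ) (p : Pat) :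
    ∑ i ∈ s, combSum (t i) u v p = combSum (fun q => ∑ i ∈ s, t i q) u v p := by
  simp only [combSum]
  rw [Finset.sum_comm]; refine Finset.sum_congr rfl fun _ _ => ?_
  rw [Finset.sum_comm]; refine Finset.sum_congr rfl fun _ _ => ?_
  rw [Finset.sum_comm]; refine Finset.sum_congr rfl fun _ _ => ?_
  split_ifs
  · simp only [Finset.sum_mul]
  · simp

theorem combSum_sum_second {ι : Type*} (s : Finset ι) (t : ι → Pat → ℚ) (u v : Pat → ℚ)
    (p : Pat) : ∑ i ∈ s, combSum u (t i) v p = combSum u (fun q => ∑ i ∈ s, t i q) v p := by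
  simp only [combSum]
  rw [Finset.sum_comm]; refine Finset.sum_congr rfl fun _ _ => ?_
  rw [Finset.sum_comm]; refine Finset.sum_congr rfl fun _ _ => ?_
  rw [Finset.sum_comm]; refine Finset.sum_congr rfl fun _ _ => ?_
  split_ifs
  · simp only [Finset.sum_mul, Finset.mul_sum]
  · simp

theorem combSum_sum_third {ι : Type*} (s : Finset ι) (t : ι → Pat → ℚ) (u v : Pat → ℚ) (p : Pat) :
    ∑ i ∈ s, combSum u v (t i) p = combSum u v (fun q => ∑ i ∈ s, t i q) p := by
  simp only [combSum]
  rw [Finset.sum_comm]; refine Finset.sum_congr rfl fun _ _ => ?_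
  rw [Finset.sum_comm]; refine Finset.sum_congr rfl fun _ _ => ?_
  rw [Finset.sum_comm]; refine Finset.sum_congr rfl fun _ _ => ?_
  split_ifs
  · simp only [Finset.mul_sum]
  · simp

-- A subgraph has at most one pattern, so at most one term of the triple sum survives.
open Classical in
theorem ite_isF_glue {n : ℕ} {S₁ S₂ S₃ : Finset (Sym2 (ℕ × ℕ))} (h₁ : S₁ ⊆ edges n)
    (h₂ : S₂ ⊆ edges n) (h₃ : S₃ ⊆ edges n) (p : Pat) (x₁ x₂ x₃ : ℚ) :
    (if IsF (n + 1) p (glue n S₁ S₂ S₃) then x₁ * x₂ * x₃ else 0) =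
      combSum (fun q => if IsF n q S₁ then x₁ else 0) (fun q => if IsF n q S₂ then x₂ else 0)
        (fun q => if IsF n q S₃ then x₃ else 0) p := by
  rw [isF_glue h₁ h₂ h₃, combSum]
  have uniq : ∀ S, (∀ q, ¬ IsF n q S) ∨ ∃ q₀, ∀ q, IsF n q S ↔ q = q₀ := by
    intro S
    by_cases h : ∃ q, IsF n q S
    · obtain ⟨q₀, hq₀⟩ := h
      exact Or.inr ⟨q₀, fun q => ⟨fun hq => hq.unique hq₀, fun hq => hq ▸ hq₀⟩⟩
    · exact Or.inl (not_exists.1 h)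
  rcases uniq S₁ with u₁ | ⟨q₁, u₁⟩
  · simp [u₁]
  rcases uniq S₂ with u₂ | ⟨q₂, u₂⟩
  · simp [u₂]
  rcases uniq S₃ with u₃ | ⟨q₃, u₃⟩
  · simp [u₃]
  simp only [u₁, u₂, u₃]
  rw [Finset.sum_eq_single q₁, Finset.sum_eq_single q₂, Finset.sum_eq_single q₃]
  · simp
  all_goals simp +contextual

theorem Z_succ {n : ℕ} {w w₁ w₂ w₃ : Finset (Sym2 (ℕ × ℕ)) → ℚ}
    (hw : ∀ S₁ ⊆ edges n, ∀ S₂ ⊆ edges n, ∀ S₃ ⊆ edges n,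
      w (glue n S₁ S₂ S₃) = w₁ S₁ * w₂ S₂ * w₃ S₃) (p : Pat) :
    Z (n + 1) p w = combSum (Z n · w₁) (Z n · w₂) (Z n · w₃) p := by
  classical
  rw [Z, sum_powerset_edges_succ]
  have : ∀ S₁ ∈ (edges n).powerset, ∀ S₂ ∈ (edges n).powerset, ∀ S₃ ∈ (edges n).powerset,
      (if IsF (n + 1) p (glue n S₁ S₂ S₃) then w (glue n S₁ S₂ S₃) else 0) =
      combSum (fun q => if IsF n q S₁ then w₁ S₁ else 0) (fun q => if IsF n q S₂ then w₂ S₂ else 0)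
        (fun q => if IsF n q S₃ then w₃ S₃ else 0) p := by
    intro S₁ h₁ S₂ h₂ S₃ h₃
    rw [Finset.mem_powerset] at h₁ h₂ h₃
    rw [← ite_isF_glue h₁ h₂ h₃, hw S₁ h₁ S₂ h₂ S₃ h₃]
  rw [Finset.sum_congr rfl fun S₁ h₁ => Finset.sum_congr rfl fun S₂ h₂ =>
    Finset.sum_congr rfl fun S₃ h₃ => this S₁ h₁ S₂ h₂ S₃ h₃]
  simp only [combSum_sum_first, combSum_sum_second, combSum_sum_third]
  rfl

theorem Pat.sum_univ (f : Pat → ℚ) : ∑ p, f p = f .T + f .B + f .A + f .O + f .H := by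
  change ∑ p ∈ ({.T, .B, .A, .O, .H} : Finset Pat), f p = _
  simp [add_assoc]

section CombSum

variable {u : Pat → ℚ} {f g h : ℚ}

/-- The marked copy is the left one. Only three output patterns are computed, because only the first
three columns of `L` are needed. -/
theorem combSum_first (hT : u .T = f) (hB : u .B = g) (hA : u .A = g) (hO : u .O = g)
    (hH : u .H = h) (t : Pat → ℚ) :
    combSum t u u .T = 4 * f * g * t .T + f ^ 2 * t .B + f ^ 2 * t .A ∧
    combSum t u u .B = (3 * g ^ 2 + f * h) * t .T + 3 * f * g * t .B + f * g * t .A ∧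
    combSum t u u .A = (3 * g ^ 2 + f * h) * t .T + f * g * t .B + 3 * f * g * t .A := by
  refine ⟨?_, ?_, ?_⟩ <;>
  · simp +decide only [combSum, Pat.sum_univ, hT, hB, hA, hO, hH, if_true, if_false]
    ring

theorem combSum_second (hT : u .T = f) (hB : u .B = g) (hA : u .A = g) (hO : u .O = g)
    (hH : u .H = h) (t : Pat → ℚ) :
    combSum u t u .T = 4 * f * g * t .T + f ^ 2 * t .B + f ^ 2 * t .O ∧
    combSum u t u .B = (3 * g ^ 2 + f * h) * t .T + 3 * f * g * t .B + f * g * t .O ∧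
    combSum u t u .A = g ^ 2 * t .T + f * g * t .B + 4 * f * g * t .A + f * g * t .O +
      f ^ 2 * t .H := by
  refine ⟨?_, ?_, ?_⟩ <;>
  · simp +decide only [combSum, Pat.sum_univ, hT, hB, hA, hO, hH, if_true, if_false]
    ring

theorem combSum_uniform (hT : u .T = f) (hB : u .B = g) (hA : u .A = g) (hO : u .O = g)
    (hH : u .H = h) :
    combSum u u u .T = 6 * f ^ 2 * g ∧
    combSum u u u .B = 7 * f * g ^ 2 + f ^ 2 * h ∧
    combSum u u u .A = 7 * f * g ^ 2 + f ^ 2 * h ∧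
    combSum u u u .O = 7 * f * g ^ 2 + f ^ 2 * h ∧
    combSum u u u .H = 12 * f * g * h + 14 * g ^ 3 := by
  refine ⟨?_, ?_, ?_, ?_, ?_⟩ <;>
  · simp +decide only [combSum, Pat.sum_univ, hT, hB, hA, hO, hH, if_true, if_false]
    ring

end CombSum

/-! ### The total counts. -/

/-- The number of the spanning forests of `SG(n)` with corner partition `p`. -/
noncomputable def total (n : ℕ) (p : Pat) : ℚ := Z n p fun _ => 1

theorem total_succ (n : ℕ) (p : Pat) :
    total (n + 1) p = combSum (total n) (total n) (total n) p :=
  Z_succ (by simp) p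

theorem conn_singleton {V : Type*} {u v c d : V} : Conn ({s(u, v)} : Set (Sym2 V)) c d ↔
    c = d ∨ (c = u ∧ v = d ∨ c = v ∧ u = d) := by
  rw [← insert_empty_eq, conn_insert]
  simp only [conn_empty]

theorem acyc_singleton {V : Type*} (u v : V) : Acyc ({s(u, v)} : Set (Sym2 V)) := by
  rw [← insert_empty_eq, acyc_insert (Set.notMem_empty _)]
  exact ⟨acyc_empty, conn_empty.1⟩

-- Enumeration of the eight subsets of a triangle; only the full one contains a cycle.
open Classical in
theorem total_zero : total 0 .T = 3 ∧ total 0 .B = 1 ∧ total 0 .A = 1 ∧ total 0 .O = 1 ∧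
    total 0 .H = 1 := by
  have key : ∀ w : Finset (Sym2 (ℕ × ℕ)) → ℚ, ∑ S ∈ (edges 0).powerset, w S =
      w ∅ + w {s((1, 0), (0, 1))} + w {s((0, 0), (0, 1))} +
        w {s((0, 0), (0, 1)), s((1, 0), (0, 1))} + w {s((0, 0), (1, 0))} +
        w {s((0, 0), (1, 0)), s((1, 0), (0, 1))} + w {s((0, 0), (1, 0)), s((0, 0), (0, 1))} +
        w {s((0, 0), (1, 0)), s((0, 0), (0, 1)), s((1, 0), (0, 1))} := by
    intro w
    have e : edges 0 = {s((0, 0), (1, 0)), s((0, 0), (0, 1)), s((1, 0), (0, 1))} := by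
      ext; simp [edges]
    have n1 : s((0, 0), (1, 0)) ∉
        ({s((0, 0), (0, 1)), s((1, 0), (0, 1))} : Finset (Sym2 (ℕ × ℕ))) := by decide
    have n2 : s((0, 0), (0, 1)) ∉ ({s((1, 0), (0, 1))} : Finset (Sym2 (ℕ × ℕ))) := by decide
    rw [e, Finset.sum_powerset_insert n1, Finset.sum_powerset_insert n2,
      Finset.sum_powerset_insert n2, ← insert_empty_eq (s((1, 0), (0, 1)) : Sym2 (ℕ × ℕ)),
      Finset.sum_powerset_insert (Finset.notMem_empty _),
      Finset.sum_powerset_insert (Finset.notMem_empty _),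
      Finset.sum_powerset_insert (Finset.notMem_empty _),
      Finset.sum_powerset_insert (Finset.notMem_empty _)]
    simp only [Finset.powerset_empty, Finset.sum_singleton, insert_empty_eq]
    ring
  have hc : ∀ S : Set (Sym2 (ℕ × ℕ)), Covers S (verts 0) o (a 0) (b 0) := by
    intro S v hv
    simp only [verts, Finset.coe_insert, Finset.coe_singleton, Set.mem_insert_iff,
      Set.mem_singleton_iff] at hv
    rcases hv with rfl | rfl | rfl
    · exact Or.inl (Conn.refl _ _)
    · exact Or.inr (Or.inl (Conn.refl _ _))
    · exact Or.inr (Or.inr (Conn.refl _ _))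
  have isF : ∀ (S : Finset (Sym2 (ℕ × ℕ))) (p q : Pat), Acyc (S : Set (Sym2 (ℕ × ℕ))) →
      HasPat (S : Set (Sym2 (ℕ × ℕ))) o (a 0) (b 0) q →
      (if IsF 0 p S then (1 : ℚ) else 0) = if p = q then 1 else 0 := by
    intro S p q hS hq
    have : IsF 0 p S ↔ p = q :=
      ⟨fun h => h.2.2.unique hq, fun h => ⟨hS, hc _, h ▸ hq⟩⟩
    by_cases h : p = q
    · rw [if_pos (this.2 h), if_pos h]
    · rw [if_neg (fun h' => h (this.1 h')), if_neg h]
  have not_isF : ∀ (S : Finset (Sym2 (ℕ × ℕ))) (p : Pat), ¬ Acyc (S : Set (Sym2 (ℕ × ℕ))) →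
      (if IsF 0 p S then (1 : ℚ) else 0) = 0 := fun S p hS => if_neg fun h => hS h.1
  have a3 : Acyc ({s((0, 0), (0, 1)), s((1, 0), (0, 1))} : Set (Sym2 (ℕ × ℕ))) := by
    rw [acyc_insert] <;> simp [acyc_singleton, conn_singleton]
  have hp : ∀ p, total 0 p = (if p = .H then 1 else 0) + (if p = .O then 1 else 0) +
      (if p = .A then 1 else 0) + (if p = .T then 1 else 0) + (if p = .B then 1 else 0) +
      (if p = .T then 1 else 0) + (if p = .T then 1 else 0) + 0 := by
    intro p
    rw [total, Z, key, isF _ p .H, isF _ p .O, isF _ p .A, isF _ p .T, isF _ p .B, isF _ p .T,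
      isF _ p .T, not_isF _ p]
    · rw [Finset.coe_insert, Finset.coe_insert, Finset.coe_singleton, acyc_insert] <;>
        simp [a3, conn_insert, conn_singleton]
    all_goals simp only [Finset.coe_insert, Finset.coe_singleton, Finset.coe_empty]
    all_goals first
      | simp [HasPat, conn_singleton, conn_insert, conn_empty, o, a, b, Pat.oa, Pat.ob, Pat.ab]
      | exact acyc_empty
      | exact acyc_singleton _ _
      | (rw [acyc_insert] <;> simp [acyc_singleton, conn_singleton])
  simp only [hp, reduceCtorEq, if_true, if_false]
  norm_num

/-- The last relation, f h = 3 g², is what makes the transition coefficients constant. -/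
theorem total_relations (n : ℕ) : 0 < total n .T ∧ 0 < total n .B ∧ 0 < total n .H ∧
    total n .A = total n .B ∧ total n .O = total n .B ∧
    total n .T * total n .H = 3 * total n .B ^ 2 := by
  induction n with
  | zero =>
    obtain ⟨h1, h2, h3, h4, h5⟩ := total_zero
    norm_num [h1, h2, h3, h4, h5]
  | succ n ih =>
    obtain ⟨hT, hB, hH, hA, hO, hr⟩ := ih
    obtain ⟨h1, h2, h3, h4, h5⟩ := combSum_uniform (u := total n) rfl rfl hA hO rfl
    simp only [total_succ, h1, h2, h3, h4, h5]
    refine ⟨by positivity, by positivity, by positivity, trivial, trivial, ?_⟩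
    -- At stage n+1 the difference factors as -3 f² (f h - 7 g²)(f h - 3 g²).
    linear_combination (-3 * total n .T ^ 2 * (total n .T * total n .H - 7 * total n .B ^ 2)) * hr

/-! ### Marking a vertex, and the transition matrices. -/

open Classical in
/-- The indicator of having `j` bonds at `x`. -/
noncomputable def tag (j : ℕ) (x : ℕ × ℕ) (S : Finset (Sym2 (ℕ × ℕ))) : ℚ :=
  if bonds S x = j then 1 else 0

theorem bonds_eq_of_mem_iff {S T : Finset (Sym2 (ℕ × ℕ))} {x : ℕ × ℕ}
    (h : ∀ e, x ∈ e → (e ∈ S ↔ e ∈ T)) : bonds S x = bonds T x := by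
  unfold bonds
  congr 1
  ext e
  simp only [Finset.mem_filter]
  constructor
  · rintro ⟨h1, h2⟩; exact ⟨(h e h2).1 h1, h2⟩
  · rintro ⟨h1, h2⟩; exact ⟨(h e h2).2 h1, h2⟩

theorem bonds_map (σ : ℕ × ℕ ↪ ℕ × ℕ) (S : Finset (Sym2 (ℕ × ℕ))) (x : ℕ × ℕ) :
    bonds (S.map σ.sym2Map) (σ x) = bonds S x := by
  unfold bonds
  rw [Finset.filter_map, Finset.card_map]
  congr 1
  ext e
  simp [Sym2.mem_map]

theorem mem_glue {n : ℕ} {S₁ S₂ S₃ : Finset (Sym2 (ℕ × ℕ))} {e : Sym2 (ℕ × ℕ)} :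
    e ∈ glue n S₁ S₂ S₃ ↔ e ∈ S₁ ∨ e ∈ S₂.map (shiftA n).sym2Map ∨
      e ∈ S₃.map (shiftB n).sym2Map := by
  simp only [glue, Finset.mem_union, or_assoc]

theorem exists_of_mem_map {σ : ℕ × ℕ ↪ ℕ × ℕ} {n : ℕ} {S : Finset (Sym2 (ℕ × ℕ))}
    (hS : S ⊆ edges n) {e : Sym2 (ℕ × ℕ)} (he : e ∈ S.map σ.sym2Map) {x : ℕ × ℕ} (hx : x ∈ e) :
    ∃ y ∈ verts n, σ y = x := by
  obtain ⟨e', he', rfl⟩ := Finset.mem_map.1 he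
  obtain ⟨y, hy, rfl⟩ := Sym2.mem_map.1 hx
  exact ⟨y, suppIn_edges n e' (hS he') y hy, rfl⟩

theorem bonds_glue_left {n : ℕ} {S₁ S₂ S₃ : Finset (Sym2 (ℕ × ℕ))} (h₂ : S₂ ⊆ edges n)
    (h₃ : S₃ ⊆ edges n) {x : ℕ × ℕ} (hx₁ : x.1 < 2 ^ n) (hx₂ : x.2 < 2 ^ n) :
    bonds (glue n S₁ S₂ S₃) x = bonds S₁ x := by
  refine bonds_eq_of_mem_iff fun e hx => ?_
  rw [mem_glue]
  refine ⟨?_, Or.inl⟩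
  rintro (h | h | h)
  · exact h
  · obtain ⟨y, -, rfl⟩ := exists_of_mem_map h₂ h hx
    simp only [shiftA_apply] at hx₁
    omega
  · obtain ⟨y, -, rfl⟩ := exists_of_mem_map h₃ h hx
    simp only [shiftB_apply] at hx₂
    omega

/-- The hypotheses keep the translated vertex off the junctions a_n and c_n, so no bond of another
copy reaches it. -/
theorem bonds_glue_right {n : ℕ} {S₁ S₂ S₃ : Finset (Sym2 (ℕ × ℕ))} (h₁ : S₁ ⊆ edges n)
    (h₃ : S₃ ⊆ edges n) {x : ℕ × ℕ} (hx₁ : 0 < x.1 + x.2) (hx₂ : x.2 < 2 ^ n) :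
    bonds (glue n S₁ S₂ S₃) (shiftA n x) = bonds S₂ x := by
  rw [← bonds_map (shiftA n) S₂]
  refine bonds_eq_of_mem_iff fun e hx => ?_
  rw [mem_glue]
  refine ⟨?_, fun h => Or.inr (Or.inl h)⟩
  rintro (h | h | h)
  · have := add_le_of_mem_verts (suppIn_edges n e (h₁ h) _ hx)
    simp only [shiftA_apply] at this
    omega
  · exact h
  · obtain ⟨y, -, hy⟩ := exists_of_mem_map h₃ h hx
    simp only [shiftB_apply, shiftA_apply, Prod.mk.injEq] at hy
    omega

theorem Z_tag_left {n : ℕ} (j : ℕ) {x : ℕ × ℕ} (hx₁ : x.1 < 2 ^ n) (hx₂ : x.2 < 2 ^ n)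
    (p : Pat) : Z (n + 1) p (tag j x) = combSum (Z n · (tag j x)) (total n) (total n) p :=
  Z_succ (w₁ := tag j x) (fun S₁ _ S₂ h₂ S₃ h₃ => by
    simp [tag, bonds_glue_left h₂ h₃ hx₁ hx₂]) p

theorem Z_tag_right {n : ℕ} (j : ℕ) {x : ℕ × ℕ} (hx₁ : 0 < x.1 + x.2) (hx₂ : x.2 < 2 ^ n)
    (p : Pat) :
    Z (n + 1) p (tag j (shiftA n x)) = combSum (total n) (Z n · (tag j x)) (total n) p :=
  Z_succ (w₂ := tag j x) (fun S₁ h₁ S₂ _ S₃ h₃ => by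
    simp [tag, bonds_glue_right h₁ h₃ hx₁ hx₂]) p

/-- The proportions of the forests with `j` bonds at `x`, for the five partitions. -/
noncomputable def prop (j n : ℕ) (x : ℕ × ℕ) : Fin 5 → ℚ :=
  ![Z n .T (tag j x) / total n .T, Z n .B (tag j x) / total n .B, Z n .A (tag j x) / total n .A,
    Z n .O (tag j x) / total n .O, Z n .H (tag j x) / total n .H]

/-- Restricting to v with vanishing last two coordinates makes the recursions for the patterns T, B,
A sufficient. -/
theorem prop_left {n : ℕ} (j : ℕ) {x : ℕ × ℕ} (hx₁ : x.1 < 2 ^ n) (hx₂ : x.2 < 2 ^ n)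
    {v : Fin 5 → ℚ} (h3 : v 3 = 0) (h4 : v 4 = 0) :
    prop j (n + 1) x ⬝ᵥ v = prop j n x ⬝ᵥ L.mulVec v := by
  obtain ⟨hT, hB, hH, hA, hO, hr⟩ := total_relations n
  obtain ⟨u1, u2, u3, -, -⟩ := combSum_uniform (u := total n) rfl rfl hA hO rfl
  obtain ⟨t1, t2, t3⟩ := combSum_first (u := total n) rfl rfl hA hO rfl (Z n · (tag j x))
  simp only [dotProduct, prop, Fin.sum_univ_five, h3, h4, L, Matrix.mulVec, Z_tag_left j hx₁ hx₂,
    total_succ, t1, t2, t3, u1, u2, u3, hA, hO]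
  simp
  generalize total n .T = f, total n .B = g, total n .H = h at *
  -- Once h is eliminated through f h = 3 g², all powers of f and g cancel.
  obtain rfl : h = 3 * g ^ 2 / f := by field_simp; linarith
  field_simp
  ring

theorem prop_right {n : ℕ} (j : ℕ) {x : ℕ × ℕ} (hx₁ : 0 < x.1 + x.2) (hx₂ : x.2 < 2 ^ n)
    {v : Fin 5 → ℚ} (h3 : v 3 = 0) (h4 : v 4 = 0) :
    prop j (n + 1) (shiftA n x) ⬝ᵥ v = prop j n x ⬝ᵥ R.mulVec v := by
  obtain ⟨hT, hB, hH, hA, hO, hr⟩ := total_relations n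
  obtain ⟨u1, u2, u3, -, -⟩ := combSum_uniform (u := total n) rfl rfl hA hO rfl
  obtain ⟨t1, t2, t3⟩ := combSum_second (u := total n) rfl rfl hA hO rfl (Z n · (tag j x))
  simp only [dotProduct, prop, Fin.sum_univ_five, h3, h4, R, Matrix.mulVec, Z_tag_right j hx₁ hx₂,
    total_succ, t1, t2, t3, u1, u2, u3, hA, hO]
  simp
  generalize total n .T = f, total n .B = g, total n .H = h at *
  obtain rfl : h = 3 * g ^ 2 / f := by field_simp; linarith
  field_simp
  ring

theorem L_mulVec_apply_eq_zero {v : Fin 5 → ℚ} (h3 : v 3 = 0) (h4 : v 4 = 0) :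
    L.mulVec v 3 = 0 ∧ L.mulVec v 4 = 0 := by
  simp [L, Matrix.mulVec, dotProduct, Fin.sum_univ_five, h3, h4]

theorem prop_left_iterate {n : ℕ} (j m : ℕ) {x : ℕ × ℕ} (hx₁ : x.1 < 2 ^ n) (hx₂ : x.2 < 2 ^ n)
    {v : Fin 5 → ℚ} (h3 : v 3 = 0) (h4 : v 4 = 0) :
    prop j (n + m) x ⬝ᵥ v = prop j n x ⬝ᵥ (L ^ m).mulVec v := by
  induction m generalizing v with
  | zero => simp
  | succ m ih =>
    obtain ⟨k3, k4⟩ := L_mulVec_apply_eq_zero h3 h4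
    have hle : 2 ^ n ≤ 2 ^ (n + m) := Nat.pow_le_pow_right two_pos (Nat.le_add_right n m)
    rw [← Nat.add_assoc, prop_left j (hx₁.trans_le hle) (hx₂.trans_le hle) h3 h4, ih k3 k4,
      Matrix.mulVec_mulVec, ← pow_succ]

theorem L_pow_mulVec_e₁ (m : ℕ) : (L ^ m).mulVec e₁ 3 = 0 ∧ (L ^ m).mulVec e₁ 4 = 0 := by
  induction m with
  | zero => simp [e₁]
  | succ m ih =>
    rw [pow_succ', ← Matrix.mulVec_mulVec]
    exact L_mulVec_apply_eq_zero ih.1 ih.2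

/-! ### Translation of the counted trees and forests into patterns. -/

section Components

/-- Converts a count of components into the covering condition: k vertices in distinct components
inject into the set of components, and this injection is onto exactly when there are k of them. -/
theorem card_connectedComponent_eq_iff {V : Type*} [Finite V] {G : SimpleGraph V} {k : ℕ}
    {f : Fin k → V} (hf : ∀ i j, G.Reachable (f i) (f j) → i = j) :
    Nat.card G.ConnectedComponent = k ↔ ∀ v, ∃ i, G.Reachable v (f i) := by
  have hinj : Function.Injective fun i => G.connectedComponentMk (f i) := fun i j h =>
    hf i j (SimpleGraph.ConnectedComponent.exact h)
  constructor
  · intro h v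
    have hb := hinj.bijective_of_nat_card_le (by simp [h])
    obtain ⟨i, hi⟩ := hb.2 (G.connectedComponentMk v)
    exact ⟨i, SimpleGraph.ConnectedComponent.exact hi.symm⟩
  · intro h
    rw [← Nat.card_eq_of_bijective (fun i => G.connectedComponentMk (f i)) ⟨hinj, ?_⟩, Nat.card_fin]
    intro c
    induction c using SimpleGraph.ConnectedComponent.ind with
    | h v =>
      obtain ⟨i, hi⟩ := h v
      exact ⟨i, SimpleGraph.ConnectedComponent.sound hi.symm⟩

variable {n : ℕ} {S : Finset (Sym2 (ℕ × ℕ))}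

theorem spanSub_eq (n : ℕ) (S : Finset (Sym2 (ℕ × ℕ))) : spanSub n S =
    SimpleGraph.fromEdgeSet {e : Sym2 (verts n) | Sym2.map Subtype.val e ∈ S} := by
  ext u v
  change (SimpleGraph.fromEdgeSet (S : Set (Sym2 (ℕ × ℕ)))).Adj u v ↔ _
  rw [SimpleGraph.fromEdgeSet_adj, SimpleGraph.fromEdgeSet_adj, Ne, Ne, Subtype.ext_iff]
  rfl

theorem image_restrict (hS : S ⊆ edges n) :
    Sym2.map Subtype.val '' {e : Sym2 (verts n) | Sym2.map Subtype.val e ∈ S} =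
      (S : Set (Sym2 (ℕ × ℕ))) := by
  ext e
  constructor
  · rintro ⟨e', he', rfl⟩; exact he'
  · intro he
    induction e with
    | h u v =>
      have hu := suppIn_edges n _ (hS he) u (by simp)
      have hv := suppIn_edges n _ (hS he) v (by simp)
      exact ⟨s(⟨u, hu⟩, ⟨v, hv⟩), he, rfl⟩

theorem spanSub_reachable (hS : S ⊆ edges n) (u v : verts n) :
    (spanSub n S).Reachable u v ↔ Conn (S : Set (Sym2 (ℕ × ℕ))) u v := by
  rw [← image_restrict hS, conn_image Subtype.val_injective, spanSub_eq, Conn]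

theorem spanSub_isAcyclic (hS : S ⊆ edges n) :
    (spanSub n S).IsAcyclic ↔ Acyc (S : Set (Sym2 (ℕ × ℕ))) := by
  rw [← image_restrict hS, acyc_image Subtype.val_injective (Set.toFinite _), spanSub_eq, Acyc]

open Classical in
theorem mem_trees : S ∈ trees n ↔ S ⊆ edges n ∧ IsF n .T S := by
  rw [trees, Finset.mem_filter, Finset.mem_powerset]
  refine and_congr_right fun hS => ?_
  rw [SimpleGraph.isTree_iff, spanSub_isAcyclic hS, and_comm, IsF, IsForest]
  refine and_congr_right fun _ => ?_
  have : (spanSub n S).Connected ↔ ∀ u v : verts n, Conn (S : Set (Sym2 (ℕ × ℕ))) u v := by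
    rw [SimpleGraph.connected_iff]
    simp only [SimpleGraph.Preconnected, spanSub_reachable hS]
    exact and_iff_left ⟨oV n⟩
  rw [this]
  simp only [HasPat, Pat.oa, Pat.ob, Pat.ab, iff_true]
  constructor
  · intro h
    exact ⟨fun v hv => Or.inl (h ⟨v, hv⟩ (oV n)), h (oV n) (aV n), h (oV n) (bV n),
      h (aV n) (bV n)⟩
  · rintro ⟨hc, hoa, hob, -⟩
    have : ∀ v : verts n, Conn (S : Set (Sym2 (ℕ × ℕ))) v o := fun v =>
      (hc v v.2).elim id fun h => h.elim (fun h => h.trans hoa.symm) fun h => h.trans hob.symm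
    exact fun u v => (this u).trans (this v).symm

open Classical in
theorem mem_forests₂ : S ∈ forests₂ n ↔ S ⊆ edges n ∧ IsF n .B S := by
  rw [forests₂, Finset.mem_filter, Finset.mem_powerset]
  refine and_congr_right fun hS => ?_
  rw [spanSub_isAcyclic hS, IsF, IsForest]
  refine and_congr_right fun _ => ?_
  simp only [HasPat, Pat.oa, Pat.ob, Pat.ab, iff_true, Bool.false_eq_true, iff_false]
  have hpat : (Conn (S : Set (Sym2 (ℕ × ℕ))) o (a n) ∧ ¬ Conn (S : Set (Sym2 (ℕ × ℕ))) o (b n) ∧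
      ¬ Conn (S : Set (Sym2 (ℕ × ℕ))) (a n) (b n)) ↔
      (spanSub n S).Reachable (oV n) (aV n) ∧ ¬ (spanSub n S).Reachable (oV n) (bV n) := by
    rw [spanSub_reachable hS, spanSub_reachable hS]
    exact ⟨fun h => ⟨h.1, h.2.1⟩, fun h => ⟨h.1, h.2, fun h' => h.2 (h.1.trans h')⟩⟩
  rw [hpat]
  refine and_congr_left fun ⟨hoa, hob⟩ => ?_
  -- The corners o and b represent the two trees, a being joined to o.
  rw [card_connectedComponent_eq_iff (f := ![oV n, bV n])]
  · simp only [Fin.exists_fin_two, Subtype.forall, spanSub_reachable hS]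
    rw [spanSub_reachable hS] at hoa
    refine forall₂_congr fun v _ => ⟨fun h => h.imp id Or.inr, fun h => ?_⟩
    rcases h with h | h | h
    · exact Or.inl h
    · exact Or.inl (h.trans hoa.symm)
    · exact Or.inr h
  · have hbo : ¬ (spanSub n S).Reachable (bV n) (oV n) := fun h => hob h.symm
    intro i j
    fin_cases i <;> fin_cases j <;> simp [hob, hbo]

open Classical in
theorem mem_forests₃ : S ∈ forests₃ n ↔ S ⊆ edges n ∧ IsF n .H S := by
  rw [forests₃, Finset.mem_filter, Finset.mem_powerset]
  refine and_congr_right fun hS => ?_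
  rw [spanSub_isAcyclic hS, IsF, IsForest]
  refine and_congr_right fun _ => ?_
  simp only [HasPat, Pat.oa, Pat.ob, Pat.ab, Bool.false_eq_true, iff_false]
  have hpat : (¬ Conn (S : Set (Sym2 (ℕ × ℕ))) o (a n) ∧ ¬ Conn (S : Set (Sym2 (ℕ × ℕ))) o (b n) ∧
      ¬ Conn (S : Set (Sym2 (ℕ × ℕ))) (a n) (b n)) ↔
      ¬ (spanSub n S).Reachable (oV n) (aV n) ∧ ¬ (spanSub n S).Reachable (oV n) (bV n) ∧
        ¬ (spanSub n S).Reachable (aV n) (bV n) := by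
    rw [spanSub_reachable hS, spanSub_reachable hS, spanSub_reachable hS]
    rfl
  rw [hpat]
  refine and_congr_left fun ⟨hoa, hob, hab⟩ => ?_
  rw [card_connectedComponent_eq_iff (f := ![oV n, aV n, bV n])]
  · simp only [Fin.exists_fin_succ, Subtype.forall, spanSub_reachable hS]
    refine forall₂_congr fun v _ => ?_
    simp [oV, aV, bV]
  · have hbo : ¬ (spanSub n S).Reachable (bV n) (oV n) := fun h => hob h.symm
    have hao : ¬ (spanSub n S).Reachable (aV n) (oV n) := fun h => hoa h.symm
    have hba : ¬ (spanSub n S).Reachable (bV n) (aV n) := fun h => hab h.symm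
    intro i j
    fin_cases i <;> fin_cases j <;> simp [hob, hbo, hoa, hao, hab, hba]

open Classical in
theorem card_div_card_eq {s : Finset (Finset (Sym2 (ℕ × ℕ)))} {p : Pat}
    (hs : ∀ S, S ∈ s ↔ S ⊆ edges n ∧ IsF n p S) (j : ℕ) (x : ℕ × ℕ) :
    ((s.filter fun S => bonds S x = j).card : ℚ) / (s.card : ℚ) =
      Z n p (tag j x) / total n p := by
  have : s = (edges n).powerset.filter (IsF n p) := by
    ext S; rw [hs, Finset.mem_filter, Finset.mem_powerset]
  subst this
  rw [Finset.filter_filter, total, Z, Z]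
  congr 1
  · rw [Finset.card_filter]
    push_cast
    refine Finset.sum_congr rfl fun S _ => ?_
    by_cases h1 : IsF n p S <;> simp [h1, tag]
  · rw [Finset.card_filter]
    push_cast
    rfl

theorem F_eq (j n : ℕ) (x : ℕ × ℕ) : F j n x = Z n .T (tag j x) / total n .T := by
  rw [F, ← card_div_card_eq fun S => mem_trees]

theorem G_eq (j n : ℕ) (x : ℕ × ℕ) : G j n x = Z n .B (tag j x) / total n .B := by
  rw [G, ← card_div_card_eq fun S => mem_forests₂]

theorem H_eq (j n : ℕ) (x : ℕ × ℕ) : H j n x = Z n .H (tag j x) / total n .H := by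
  rw [H, ← card_div_card_eq fun S => mem_forests₃]

end Components

/-! ### Reflections of the gasket. -/

section Symmetry

-- An involutive automorphism permutes the spanning subgraphs, moves the marked vertex and permutes
-- the corners, hence the patterns.
open Classical in
theorem Z_tag_symm {n : ℕ} {σ : ℕ × ℕ → ℕ × ℕ} (hσ : Function.Involutive σ)
    (hV : ∀ v ∈ verts n, σ v ∈ verts n) (hE : ∀ e ∈ edges n, Sym2.map σ e ∈ edges n) {p q : Pat}
    (hpq : ∀ S : Set (Sym2 (ℕ × ℕ)),
      IsForest S (verts n) (σ o) (σ (a n)) (σ (b n)) q ↔ IsForest S (verts n) o (a n) (b n) p)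
    (j : ℕ) (x : ℕ × ℕ) : Z n p (tag j (σ x)) = Z n q (tag j x) := by
  set τ : ℕ × ℕ ↪ ℕ × ℕ := ⟨σ, hσ.injective⟩ with hτ
  have himg : σ '' (verts n : Set (ℕ × ℕ)) = verts n := by
    ext v
    constructor
    · rintro ⟨w, hw, rfl⟩; exact hV w hw
    · intro hv; exact ⟨σ v, hV v hv, hσ v⟩
  have hcoe : ∀ S : Finset (Sym2 (ℕ × ℕ)), ((S.map τ.sym2Map : Finset _) : Set (Sym2 (ℕ × ℕ))) =
      Sym2.map σ '' ↑S := fun S => by rw [Finset.coe_map]; rfl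
  have hsub : ∀ S ∈ (edges n).powerset, S.map τ.sym2Map ∈ (edges n).powerset := by
    intro S hS
    rw [Finset.mem_powerset] at hS ⊢
    intro e he
    obtain ⟨e', he', rfl⟩ := Finset.mem_map.1 he
    exact hE e' (hS he')
  have hinv : ∀ S : Finset (Sym2 (ℕ × ℕ)), (S.map τ.sym2Map).map τ.sym2Map = S := by
    intro S
    rw [← Finset.coe_inj, hcoe, hcoe, ← Set.image_comp, ← Sym2.map_comp, hσ.comp_self, Sym2.map_id,
      Set.image_id]
  have hF : ∀ S, IsF n p (S.map τ.sym2Map) ↔ IsF n q S := by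
    intro S
    rw [IsF, ← hpq, hcoe, IsF, ← isForest_image hσ.injective S.finite_toSet, himg]
  symm
  rw [Z, Z]
  refine Finset.sum_nbij' (fun S => S.map τ.sym2Map) (fun S => S.map τ.sym2Map) hsub hsub
    (fun S _ => hinv S) (fun S _ => hinv S) fun S _ => ?_
  have : bonds (S.map τ.sym2Map) (σ x) = bonds S x := bonds_map τ S x
  simp only [hF, tag, this]

theorem isForest_swap {V : Type*} {S : Set (Sym2 V)} {W : Set V} {o a b : V} {p q : Pat}
    (h₁ : p.oa = q.ob) (h₂ : p.ob = q.oa) (h₃ : p.ab = q.ab) :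
    IsForest S W o b a q ↔ IsForest S W o a b p := by
  simp only [IsForest, Covers, HasPat, h₁, h₂, h₃, Conn.comm (u := b) (v := a)]
  exact and_congr_right fun _ => and_congr (forall₂_congr fun v _ => by tauto) (by tauto)

theorem isForest_reverse {V : Type*} {S : Set (Sym2 V)} {W : Set V} {o a b : V} {p q : Pat}
    (h₁ : p.oa = q.ab) (h₂ : p.ob = q.ob) (h₃ : p.ab = q.oa) :
    IsForest S W b a o q ↔ IsForest S W o a b p := by
  simp only [IsForest, Covers, HasPat, h₁, h₂, h₃, Conn.comm (u := b) (v := a),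
    Conn.comm (u := b) (v := o), Conn.comm (u := a) (v := o)]
  exact and_congr_right fun _ => and_congr (forall₂_congr fun v _ => by tauto) (by tauto)

theorem mem_verts_succ {n : ℕ} {v : ℕ × ℕ} : v ∈ verts (n + 1) ↔
    v ∈ verts n ∨ (∃ w ∈ verts n, shiftA n w = v) ∨ ∃ w ∈ verts n, shiftB n w = v := by
  rw [← Finset.mem_coe, coe_verts_succ]
  simp [or_assoc]

/-- A family of maps permuting the three copies of each stage preserves the vertices and the
edges. -/
theorem map_mem_of_copies {σ : ℕ → ℕ × ℕ → ℕ × ℕ}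
    (h0 : ∀ v ∈ verts 0, σ 0 v ∈ verts 0) (h0' : ∀ e ∈ edges 0, Sym2.map (σ 0) e ∈ edges 0)
    (ι : ℕ → Fin 3 → ℕ × ℕ → ℕ × ℕ) (hι : ∀ n, ι n = ![id, shiftA n, shiftB n]) (π : Fin 3 → Fin 3)
    (hσ : ∀ n i, ∀ v ∈ verts n, σ (n + 1) (ι n i v) = ι n (π i) (σ n v)) (n : ℕ) :
    (∀ v ∈ verts n, σ n v ∈ verts n) ∧ ∀ e ∈ edges n, Sym2.map (σ n) e ∈ edges n := by
  induction n with
  | zero => exact ⟨h0, h0'⟩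
  | succ n ih =>
    have hv : ∀ v, v ∈ verts (n + 1) ↔ ∃ i, ∃ w ∈ verts n, ι n i w = v := by
      intro v
      rw [mem_verts_succ]
      simp [Fin.exists_fin_succ, hι, -Prod.exists]
    have he : ∀ e, e ∈ edges (n + 1) ↔ ∃ i, ∃ e' ∈ edges n, Sym2.map (ι n i) e' = e := by
      intro v
      rw [mem_edges_succ]
      simp [Fin.exists_fin_succ, hι]
    constructor
    · intro v h
      obtain ⟨i, w, hw, rfl⟩ := (hv v).1 h
      exact (hv _).2 ⟨π i, σ n w, ih.1 w hw, (hσ n i w hw).symm⟩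
    · intro e h
      obtain ⟨i, e', he', rfl⟩ := (he e).1 h
      refine (he _).2 ⟨π i, _, ih.2 e' he', ?_⟩
      rw [Sym2.map_map, Sym2.map_map]
      exact Sym2.map_congr fun v hv => (hσ n i v (suppIn_edges n e' he' v hv)).symm

theorem tilde_involutive : Function.Involutive tilde := fun _ => rfl

theorem tilde_mem (n : ℕ) :
    (∀ v ∈ verts n, tilde v ∈ verts n) ∧ ∀ e ∈ edges n, Sym2.map tilde e ∈ edges n := by
  refine map_mem_of_copies (σ := fun _ => tilde) (by simp [verts, tilde]) ?_ _ (fun _ => rfl)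
    ![0, 2, 1] ?_ n
  · simp [edges, tilde]
  · intro n i v _
    fin_cases i <;> simp [tilde, shiftA_apply, shiftB_apply]

theorem Z_tag_tilde_T (j n : ℕ) (x : ℕ × ℕ) : Z n .T (tag j (tilde x)) = Z n .T (tag j x) :=
  Z_tag_symm tilde_involutive (tilde_mem n).1 (tilde_mem n).2
    (fun _ => isForest_swap rfl rfl rfl) j x

theorem Z_tag_tilde_B (j n : ℕ) (x : ℕ × ℕ) : Z n .B (tag j (tilde x)) = Z n .A (tag j x) :=
  Z_tag_symm (p := .B) (q := .A) tilde_involutive (tilde_mem n).1 (tilde_mem n).2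
    (fun _ => isForest_swap rfl rfl rfl) j x

/-- The reflection `hat n`, extended by the identity outside the triangle. -/
def hatExt (n : ℕ) (x : ℕ × ℕ) : ℕ × ℕ := if x.1 + x.2 ≤ 2 ^ n then hat n x else x

theorem hatExt_eq {n : ℕ} {x : ℕ × ℕ} (h : x.1 + x.2 ≤ 2 ^ n) : hatExt n x = hat n x := if_pos h

/-- Outside the triangle truncated subtraction spoils `hat n`; the extension by the identity gives
the global involution that `Z_tag_symm` requires. -/
theorem hatExt_involutive (n : ℕ) : Function.Involutive (hatExt n) := by
  intro x
  by_cases h : x.1 + x.2 ≤ 2 ^ n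
  · have h' : (hat n x).1 + (hat n x).2 ≤ 2 ^ n := by simp only [hat]; omega
    rw [hatExt_eq h, hatExt_eq h']
    ext <;> simp only [hat]
    omega
  · simp [hatExt, h]

/-- The reflection of stage n+1 exchanges the left and top copies, fixes the right one, and acts
inside each as the reflection of stage n. -/
theorem hatExt_mem (n : ℕ) :
    (∀ v ∈ verts n, hatExt n v ∈ verts n) ∧ ∀ e ∈ edges n, Sym2.map (hatExt n) e ∈ edges n := by
  refine map_mem_of_copies (σ := hatExt) (by simp [verts, hatExt, hat]) ?_ _ (fun _ => rfl)
    ![2, 1, 0] ?_ n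
  · simp [edges, hatExt, hat]
  · intro n i v hv
    have h := add_le_of_mem_verts hv
    have hp : 2 ^ (n + 1) = 2 ^ n + 2 ^ n := by ring
    rw [hatExt_eq h]
    fin_cases i <;>
    · simp only [Matrix.cons_val, id, shiftA_apply, shiftB_apply, Fin.zero_eta, Fin.mk_one,
        Fin.reduceFinMk]
      rw [hatExt, if_pos (by omega)]
      ext <;> simp only [hat] <;> omega

theorem Z_tag_hat_B (j n : ℕ) {x : ℕ × ℕ} (hx : x.1 + x.2 ≤ 2 ^ n) :
    Z n .B (tag j (hat n x)) = Z n .O (tag j x) := by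
  rw [← hatExt_eq hx]
  refine Z_tag_symm (hatExt_involutive n) (hatExt_mem n).1 (hatExt_mem n).2 (fun S => ?_) j x
  have ho : hatExt n o = b n := by rw [hatExt_eq (by simp [o])]; simp [hat, o, b]
  have ha : hatExt n (a n) = a n := by rw [hatExt_eq (by simp [a])]; simp [hat, a]
  have hb : hatExt n (b n) = o := by rw [hatExt_eq (by simp [b])]; simp [hat, o, b]
  rw [ho, ha, hb]
  exact isForest_reverse rfl rfl rfl

end Symmetry

/-! ### Assembly. -/

theorem F_tilde (j n : ℕ) (x : ℕ × ℕ) : F j n (tilde x) = F j n x := by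
  rw [F_eq, F_eq, Z_tag_tilde_T]

theorem F_eq_prop_dotProduct (j n : ℕ) (x : ℕ × ℕ) : F j n x = prop j n x ⬝ᵥ e₁ := by
  simp [F_eq, prop, e₁, dotProduct, Fin.sum_univ_five]

/-- Reflecting x turns the isolated corner b into a (tilde) or o (hat), and the three corresponding
totals agree. -/
theorem B_apply {j n : ℕ} {v : Fin 3 → ℕ × ℕ} {i : Fin 3} (h : (v i).1 + (v i).2 ≤ 2 ^ n) :
    B j n n v i = prop j n (v i) := by
  obtain ⟨-, -, -, hA, hO, -⟩ := total_relations n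
  change ![F j n (v i), G j n (v i), G j n (tilde (v i)), G j n (hat n (v i)), H j n (v i)] = _
  rw [prop, F_eq, G_eq, G_eq, G_eq, H_eq, Z_tag_tilde_B, Z_tag_hat_B j n h, hA, hO]

theorem vtxOne_succ (k : ℕ) (i : Fin 3) : vtxOne (k + 1) i = shiftA (k + 1) (vtx k i) := by
  fin_cases i <;> simp [vtxOne, vtx, shiftA_apply, a, b, c, add_comm]

end SG

theorem mainTheorem6 (n m j : ℕ) (hn : 2 ≤ n) (hj₁ : 1 ≤ j) (hj₄ : j ≤ 4) :
    (fun i : Fin 3 => SG.F j (n + m) (SG.vtxOne (n - 1) i)) =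
        (fun i : Fin 3 => SG.F j (n + m) (SG.tilde (SG.vtxOne (n - 1) i))) ∧
      (fun i : Fin 3 => SG.F j (n + m) (SG.vtxOne (n - 1) i)) =
        Matrix.mulVec (SG.B j (n - 1) (n - 1) (SG.vtx (n - 2)) * SG.R * SG.L ^ m) SG.e₁ := by
  refine ⟨funext fun i => (SG.F_tilde _ _ _).symm, funext fun i => ?_⟩
  obtain ⟨k, rfl⟩ := Nat.exists_eq_add_of_le' hn
  have hpow : 2 ^ (k + 1) = 2 ^ k + 2 ^ k := by ring
  have hpow' : 2 ^ (k + 2) = 2 ^ (k + 1) + 2 ^ (k + 1) := by ring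
  have hpos := Nat.two_pow_pos k
  have hx : 0 < (SG.vtx k i).1 + (SG.vtx k i).2 ∧ (SG.vtx k i).1 + (SG.vtx k i).2 ≤ 2 ^ (k + 1) ∧
      (SG.vtx k i).1 < 2 ^ (k + 1) ∧ (SG.vtx k i).2 < 2 ^ (k + 1) := by
    fin_cases i <;> simp only [SG.vtx, SG.a, SG.b, SG.c, Matrix.cons_val, Fin.zero_eta, Fin.mk_one,
      Fin.reduceFinMk] <;> omega
  obtain ⟨hx0, hx1, hx2, hx3⟩ := hx
  obtain ⟨h3, h4⟩ := SG.L_pow_mulVec_e₁ m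
  have e1 : k + 2 - 1 = k + 1 := rfl
  have e2 : k + 2 - 2 = k := rfl
  -- From stage n+m down to n the vertex lies in the left copy, m times; at stage n it lies in the
  -- right copy, and its preimage is the vertex of SG(n-1) given by `vtx`.
  rw [e1, e2, SG.vtxOne_succ, SG.F_eq_prop_dotProduct, SG.prop_left_iterate,
    SG.prop_right j hx0 hx3 h3 h4, ← SG.B_apply hx1, ← Matrix.mulVec_mulVec,
    ← Matrix.mulVec_mulVec]
  · rfl
  · simp only [SG.shiftA_apply]; omega
  · simp only [SG.shiftA_apply]; omega
  · rfl
  · rfl
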